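/- **Terms.** Let $\mathrm{Ter}(\lambda_{\mathsf{letrec}})$ be the set of closed finite terms, up to renaming of bound variables, built from variables, abstractions $\lambda x.L$, applications $L_0\,L_1$, and $\mathsf{letrec}\ f_1=L_1,\dots,f_k=L_k\ \mathsf{in}\ L_{k+1}$ with $k\ge 0$, in which $f_1,\dots,f_k$ are bound in all of $L_1,\dots,L_{k+1}$. Infinite $\lambda$-terms are the closed, finite or infinite, terms built from variables, abstractions and applications. **Unfolding.** The unfolding rewrite relation is the closure under contexts of the rules $\mathsf{letrec}\,B\,\mathsf{in}\,L_0L_1\to(\mathsf{letrec}\,B\,\mathsf{in}\,L_0)(\mathsf{letrec}\,B\,\mathsf{in}\,L_1)$; $\mathsf{letrec}\,B\,\mathsf{in}\,\lambda x.L\to\lambda x.\,\mathsf{letrec}\,B\,\mathsf{in}\,L$; $\mathsf{letrec}\,B\,\mathsf{in}\,\mathsf{letrec}\,C\,\mathsf{in}\,L\to\mathsf{letrec}\,B,C\,\mathsf{in}\,L$; $\mathsf{letrec}\,B\,\mathsf{in}\,f_i\to\mathsf{letrec}\,B\,\mathsf{in}\,L_i$ if $f_i=L_i$ is in $B$; $\mathsf{letrec}\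 \mathsf{in}\,L\to L$; $\mathsf{letrec}\,B\,\mathsf{in}\,L\to\mathsf{letrec}\,B'\,\mathsf{in}\,L$ if $B'\subsetneq B$ consists of the equations of $B$ for the recursion variables that are reachable from $L$. $L$ *expresses* (unfolds to) an infinite $\lambda$-term $M$ if there is a strongly convergent unfolding rewrite sequence of length at most $\omega$ from $L$ to $M$. **The proof system $\mathbf{Reg}^+_{\mathsf{letrec}}$.** Its formulas are prefixed terms $(x_1\dots x_n)L$, where $L$ may contain constants from an additional infinite set. Derivations are finite prooftrees built from marked assumptions $((\vec x)\,\mathsf c)^u$, with $\mathsf c$ a constant and $u$ a marker, and from the following axioms and rules: * axioms $(\vec x y)\,y$; * ($\lambda$) from $(\vec x y)L$ infer $(\vec x)\lambda y.L$; * ($@$) from $(\vec x)L_0$ and $(\vec x)L_1$ infer $(\vec x)L_0L_1$; * ($\mathsf S$) from $(x_1\dots x_{n-1})L$ infer $(x_1\dots x_n)L$ if $x_n$ does not occur in $L$; * ($\mathrm{FIX}_{\mathsf{letrec}}$) from $(\vec x)L_j[f_1:=\mathsf c_1,\dots,f_k:=\mathsf c_k]$ for $j=1,\dots,k+1$ infer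 $(\vec x)\,\mathsf{letrec}\ f_1=L_1,\dots,f_k=L_k\ \mathsf{in}\ L_{k+1}$, discharging the assumptions $((\vec x)\,\mathsf c_i)^{u_i}$, with distinct markers $u_1,\dots,u_k$, in the immediate subderivations $D_1,\dots,D_{k+1}$. Here $\mathsf c_1,\dots,\mathsf c_k$ are distinct constants that do not occur in $L_1,\dots,L_{k+1}$, nor in open assumptions of $D_1,\dots,D_{k+1}$ other than the discharged ones. Side-conditions: $|\vec y|\ge|\vec x|$ for every formula $(\vec y)N$ on a thread in some $D_j$ from one of the discharged assumptions downwards; and, for every bottommost instance of this rule in a derivation, the subderivation ending with that instance is guarded on access path cycles. An *access path* of a derivation starts at its conclusion; at ($\lambda$), ($@$), ($\mathsf S$) it steps from the conclusion to a premise; at ($\mathrm{FIX}_{\mathsf{letrec}}$) it steps from the conclusion to the rightmost premise (that for $L_{k+1}$); from a marked assumption $((\vec x)\,\mathsf c_i)^{u_i}$ it steps to the $i$-th premise of the instance of ($\mathrm{FIX}_{\mathsf{letrec}}$) that discharges it. A derivation is *guarded on access path cycles* if each cycle on each access path (a segment between two visits of the same formula occurrence) contains at least one instance of ($\lambda$)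 or ($@$). A formula is *derivable* in $\mathbf{Reg}^+_{\mathsf{letrec}}$ if it is the conclusion of a derivation in which all marked assumptions are discharged. **Theorem.** $\mathbf{Reg}^+_{\mathsf{letrec}}$ is sound and complete for the property of $\lambda_{\mathsf{letrec}}$-terms to unfold to an infinite $\lambda$-term. That is, for every $L\in\mathrm{Ter}(\lambda_{\mathsf{letrec}})$ the following are equivalent: 1. $L$ expresses an infinite $\lambda$-term; 2. the formula $()L$, with empty prefix, is derivable in $\mathbf{Reg}^+_{\mathsf{letrec}}$. -/

import Mathlib

namespace LetrecUnf

/-- Finite terms of the lambda-calculus with letrec, up to renaming of bound variables (de Bruijn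
indices), over the signature extended by constants `const c`. In `letrec k defs body` the `k`
recursion variables are bound in all of `defs` and in `body`: there index `i < k` denotes the
recursion variable that is defined by `defs i`, and index `k + i` denotes the variable `i` of the
surrounding context. -/
inductive Tm : Type
  | var (i : ℕ) : Tm
  | const (c : ℕ) : Tm
  | lam (L : Tm) : Tm
  | app (L₀ L₁ : Tm) : Tm
  | letrec (k : ℕ) (defs : Fin k → Tm) (body : Tm) : Tm

namespace Tm

/-- `IsTerm n L`: `L` is a letrec-term without constants over the abstraction prefix
`x₁, …, xₙ`, i.e. all free variables of `L` are among these. The plain letrec-terms are those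
with `IsTerm 0 L`. -/
def IsTerm : ℕ → Tm → Prop
  | n, var i => i < n
  | _, const _ => False
  | n, lam L => IsTerm (n + 1) L
  | n, app L₀ L₁ => IsTerm n L₀ ∧ IsTerm n L₁
  | n, letrec k defs body => (∀ j, IsTerm (n + k) (defs j)) ∧ IsTerm (n + k) body

/-- The renaming `ρ` under `k` additional binders. -/
def liftRen (k : ℕ) (ρ : ℕ → ℕ) : ℕ → ℕ :=
  fun i => if i < k then i else ρ (i - k) + k

/-- Capture-avoiding renaming of free variables. -/
def rename : (ℕ → ℕ) → Tm → Tm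
  | ρ, var i => var (ρ i)
  | _, const c => const c
  | ρ, lam L => lam (rename (liftRen 1 ρ) L)
  | ρ, app L₀ L₁ => app (rename ρ L₀) (rename ρ L₁)
  | ρ, letrec k defs body =>
      letrec k (fun j => rename (liftRen k ρ) (defs j)) (rename (liftRen k ρ) body)

/-- Weakening of the context by `m` innermost variables that do not occur. -/
def shift (m : ℕ) (L : Tm) : Tm := rename (fun i => i + m) L

/-- `FreeIn i L`: the variable `i` occurs free in `L`. -/
def FreeIn : ℕ → Tm → Prop
  | i, var j => i = j
  | _, const _ => False
  | i, lam L => FreeIn (i + 1) L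
  | i, app L₀ L₁ => FreeIn i L₀ ∨ FreeIn i L₁
  | i, letrec k defs body => (∃ j, FreeIn (i + k) (defs j)) ∨ FreeIn (i + k) body

/-- `HasConst c L`: the constant `c` occurs in `L`. -/
def HasConst : ℕ → Tm → Prop
  | _, var _ => False
  | c, const c' => c = c'
  | c, lam L => HasConst c L
  | c, app L₀ L₁ => HasConst c L₀ ∨ HasConst c L₁
  | c, letrec _ defs body => (∃ j, HasConst c (defs j)) ∨ HasConst c body

/-- Auxiliary form of `instConsts` under `d` local binders. -/
def instConstsAux {k : ℕ} (c : Fin k → ℕ) : ℕ → Tm → Tm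
  | d, var i =>
      if i < d then var i
      else if h : i - d < k then const (c ⟨i - d, h⟩)
      else var (i - k)
  | _, const c' => const c'
  | d, lam L => lam (instConstsAux c (d + 1) L)
  | d, app L₀ L₁ => app (instConstsAux c d L₀) (instConstsAux c d L₁)
  | d, letrec m defs body =>
      letrec m (fun j => instConstsAux c (d + m) (defs j)) (instConstsAux c (d + m) body)

/-- The substitution `L[f₁ := c₁, …, fₖ := cₖ]` of constants for the `k` innermost variables. -/
def instConsts {k : ℕ} (c : Fin k → ℕ) (L : Tm) : Tm := instConstsAux c 0 L

/-- The recursion variables of the binding group `defs` that are reachable from `body`. -/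
inductive Reaches {k : ℕ} (defs : Fin k → Tm) (body : Tm) : Fin k → Prop
  | base (i : Fin k) : FreeIn (i : ℕ) body → Reaches defs body i
  | step (i j : Fin k) : Reaches defs body j → FreeIn (i : ℕ) (defs j) → Reaches defs body i

/-- The renaming that embeds `k'` recursion variables into `k` recursion variables along `e` and
leaves the variables of the surrounding context fixed. -/
def embedRen {k' k : ℕ} (e : Fin k' → Fin k) : ℕ → ℕ :=
  fun i => if h : i < k' then (e ⟨i, h⟩ : ℕ) else i - k' + k

/-- The exchange of an innermost binder with `k` recursion variables around it. -/
def exchangeRen (k : ℕ) : ℕ → ℕ :=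
  fun i => if i = 0 then k else if i ≤ k then i - 1 else i

/-- The rules for unfolding letrec-terms, at the root of a term. -/
inductive UnfRule : Tm → Tm → Prop
  /-- `letrec B in L₀ L₁ → (letrec B in L₀) (letrec B in L₁)` -/
  | app (k : ℕ) (B : Fin k → Tm) (L₀ L₁ : Tm) :
      UnfRule (letrec k B (app L₀ L₁)) (app (letrec k B L₀) (letrec k B L₁))
  /-- `letrec B in λx. L → λx. letrec B in L` -/
  | lam (k : ℕ) (B : Fin k → Tm) (L : Tm) :
      UnfRule (letrec k B (lam L))
        (lam (letrec k (fun j => rename (liftRen k (fun i => i + 1)) (B j))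
          (rename (exchangeRen k) L)))
  /-- `letrec B in letrec C in L → letrec B, C in L` -/
  | letrec (k m : ℕ) (B : Fin k → Tm) (C : Fin m → Tm) (L : Tm) :
      UnfRule (letrec k B (letrec m C L))
        (letrec (m + k) (Fin.addCases C (fun j => shift m (B j))) L)
  /-- `letrec f₁ = L₁, …, fₖ = Lₖ in fᵢ → letrec f₁ = L₁, …, fₖ = Lₖ in Lᵢ` -/
  | unfRec (k : ℕ) (B : Fin k → Tm) (i : Fin k) :
      UnfRule (letrec k B (var i)) (letrec k B (B i))
  /-- `letrec in L → L` -/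
  | nil (B : Fin 0 → Tm) (L : Tm) : UnfRule (letrec 0 B L) L
  /-- `letrec B in L → letrec B' in L`, where `B'` consists of the equations of `B` for those
  recursion variables that are reachable from `L`, and `B'` is smaller than `B`. -/
  | reduce (k k' : ℕ) (e : Fin k' → Fin k) (B : Fin k → Tm) (B' : Fin k' → Tm) (L L' : Tm) :
      k' < k → StrictMono e → (∀ i, i ∈ Set.range e ↔ Reaches B L i) →
      L = rename (embedRen e) L' → (∀ j, B (e j) = rename (embedRen e) (B' j)) →
      UnfRule (letrec k B L) (letrec k' B' L')

/-- `UnfStep d L L'`: a step of the unfolding rewrite relation, at a redex in depth `d`. -/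
inductive UnfStep : ℕ → Tm → Tm → Prop
  | root {L L' : Tm} : UnfRule L L' → UnfStep 0 L L'
  | lam {d : ℕ} {L L' : Tm} : UnfStep d L L' → UnfStep (d + 1) (lam L) (lam L')
  | appLeft {d : ℕ} {L L' : Tm} (P : Tm) : UnfStep d L L' →
      UnfStep (d + 1) (app L P) (app L' P)
  | appRight {d : ℕ} {L L' : Tm} (P : Tm) : UnfStep d L L' →
      UnfStep (d + 1) (app P L) (app P L')
  | letrecDef {d k : ℕ} (B : Fin k → Tm) (j : Fin k) {L' : Tm} (P : Tm) : UnfStep d (B j) L' →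
      UnfStep (d + 1) (letrec k B P) (letrec k (Function.update B j L') P)
  | letrecBody {d k : ℕ} (B : Fin k → Tm) {L L' : Tm} : UnfStep d L L' →
      UnfStep (d + 1) (letrec k B L) (letrec k B L')

end Tm

/-- The symbols of infinite lambda-terms (with de Bruijn indices). -/
inductive InfSym : Type
  | var (i : ℕ) : InfSym
  | lam : InfSym
  | app : InfSym

/-- The number of arguments of a symbol. -/
def InfSym.arity : InfSym → ℕ
  | .var _ => 0
  | .lam => 1
  | .app => 2

/-- The signature of infinite lambda-terms. -/
def infSig : PFunctor.{0, 0} := ⟨InfSym, fun s => Fin s.arity⟩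

/-- Finite or infinite lambda-terms up to renaming of bound variables, possibly with free
variables: the final coalgebra of the signature. -/
def InfTm : Type := infSig.M

namespace InfTm

/-- Variables. -/
def var (i : ℕ) : InfTm := PFunctor.M.mk (F := infSig) ⟨InfSym.var i, Fin.elim0⟩

/-- Abstractions. -/
def lam (M : InfTm) : InfTm := PFunctor.M.mk (F := infSig) ⟨InfSym.lam, ![M]⟩

/-- Applications. -/
def app (M N : InfTm) : InfTm := PFunctor.M.mk (F := infSig) ⟨InfSym.app, ![M, N]⟩

/-- `FreeIn i M`: the variable `i` occurs free in `M`. -/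
inductive FreeIn : ℕ → InfTm → Prop
  | var (i : ℕ) : FreeIn i (var i)
  | lam {i : ℕ} {M : InfTm} : FreeIn (i + 1) M → FreeIn i (lam M)
  | appLeft {i : ℕ} {M : InfTm} (N : InfTm) : FreeIn i M → FreeIn i (app M N)
  | appRight {i : ℕ} (M : InfTm) {N : InfTm} : FreeIn i N → FreeIn i (app M N)

/-- The closed terms are the infinite lambda-terms with empty abstraction prefix. -/
def Closed (M : InfTm) : Prop := ∀ i, ¬ FreeIn i M

end InfTm

/-- `AgreesUpTo d L M`: the symbols of `L` and of `M` in depth less than `d` coincide (so that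
`L` does not contain `letrec` in depth less than `d`). -/
inductive AgreesUpTo : ℕ → Tm → InfTm → Prop
  | zero (L : Tm) (M : InfTm) : AgreesUpTo 0 L M
  | var (d i : ℕ) : AgreesUpTo (d + 1) (Tm.var i) (InfTm.var i)
  | lam {d : ℕ} {L : Tm} {M : InfTm} : AgreesUpTo d L M →
      AgreesUpTo (d + 1) (Tm.lam L) (InfTm.lam M)
  | app {d : ℕ} {L₀ L₁ : Tm} {M₀ M₁ : InfTm} : AgreesUpTo d L₀ M₀ → AgreesUpTo d L₁ M₁ →
      AgreesUpTo (d + 1) (Tm.app L₀ L₁) (InfTm.app M₀ M₁)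

/-- `L` expresses (unfolds to) `M`: there is a strongly convergent unfolding rewrite sequence of
length at most `ω` from `L` to `M`. The redex depths `δ n` tend to infinity, and the terms of the
sequence converge to `M`. Idle steps are allowed, in order to cover finite sequences. -/
def Expresses (L : Tm) (M : InfTm) : Prop :=
  ∃ (s : ℕ → Tm) (δ : ℕ → ℕ), s 0 = L ∧
    (∀ n, s (n + 1) = s n ∨ Tm.UnfStep (δ n) (s n) (s (n + 1))) ∧
    Filter.Tendsto δ Filter.atTop Filter.atTop ∧
    ∀ d, ∀ᶠ n in Filter.atTop, AgreesUpTo d (s n) M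

/-- Prefixed terms `(x₁ … xₙ) L`, where `n` is the field `len`. In `L`, index `0` denotes the last
prefix variable `xₙ`. -/
structure Judgement : Type where
  len : ℕ
  tm : Tm

/-- Names of rule instances. Marked assumptions `hyp u` carry a marker `u`; an instance
`fixLetrec k c u` chooses constants `c 0, …, c (k-1)` for the recursion variables, and discharges
assumptions with markers `u 0, …, u (k-1)`. -/
inductive Rule : Type
  | hyp (u : ℕ) : Rule
  | nlvar : Rule
  | lam : Rule
  | app : Rule
  | vac : Rule
  | fixLetrec (k : ℕ) (c u : Fin k → ℕ) : Rule

namespace Rule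

/-- The number of premises. The last premise of `fixLetrec k c u` is the one for the in-part, the
other ones are those for the equations. -/
@[reducible] def arity : Rule → ℕ
  | hyp _ => 0
  | nlvar => 0
  | lam => 1
  | app => 2
  | vac => 1
  | fixLetrec k _ _ => k + 1

/-- The rule instance discharges assumptions with marker `v`. -/
def Discharges : Rule → ℕ → Prop
  | fixLetrec _ _ u, v => ∃ i, u i = v
  | _, _ => False

/-- The rule instance is one of the rule for letrec. -/
def IsFix : Rule → Prop
  | fixLetrec _ _ _ => True
  | _ => False

/-- The rule instance is a guard, that is, one of the rules for abstraction and application. -/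
def IsGuard : Rule → Prop
  | lam => True
  | app => True
  | _ => False

end Rule

/-- Finite prooftrees (not necessarily built from correct rule instances). -/
inductive ProofTree : Type
  | node (J : Judgement) (r : Rule) (prem : Fin r.arity → ProofTree) : ProofTree

namespace ProofTree

/-- The conclusion. -/
def concl : ProofTree → Judgement
  | node J _ _ => J

/-- The bottommost rule instance. -/
def rule : ProofTree → Rule
  | node _ r _ => r

/-- `OpenAssumption D v J`: `J` with marker `v` is an open (undischarged) assumption of `D`. -/
inductive OpenAssumption : ProofTree → ℕ → Judgement → Prop
  | hyp (J : Judgement) (v : ℕ) (prem : Fin (Rule.hyp v).arity → ProofTree) :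
      OpenAssumption (node J (Rule.hyp v) prem) v J
  | step {J : Judgement} {r : Rule} {prem : Fin r.arity → ProofTree} (j : Fin r.arity) {v : ℕ}
      {J' : Judgement} : ¬ r.Discharges v → OpenAssumption (prem j) v J' →
      OpenAssumption (node J r prem) v J'

/-- `OnThread D v J`: `J` lies on a thread in `D` from an open assumption with marker `v`
downwards. -/
inductive OnThread : ProofTree → ℕ → Judgement → Prop
  | concl {D : ProofTree} {v : ℕ} {J' : Judgement} : OpenAssumption D v J' →
      OnThread D v D.concl
  | step {J : Judgement} {r : Rule} {prem : Fin r.arity → ProofTree} (j : Fin r.arity) {v : ℕ}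
      {J' : Judgement} : ¬ r.Discharges v → OnThread (prem j) v J' →
      OnThread (node J r prem) v J'

/-- Derivations, possibly with open assumptions, without the side-condition on access path
cycles. -/
inductive IsUgDerivation : ProofTree → Prop
  /-- marked assumptions `((x₁ … xₙ) c)ᵘ` -/
  | hyp (n c v : ℕ) (prem : Fin (Rule.hyp v).arity → ProofTree) :
      IsUgDerivation (node ⟨n, Tm.const c⟩ (Rule.hyp v) prem)
  /-- axioms `(x₁ … xₙ y) y` -/
  | nlvar (n : ℕ) (prem : Fin Rule.nlvar.arity → ProofTree) :
      IsUgDerivation (node ⟨n + 1, Tm.var 0⟩ Rule.nlvar prem)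
  /-- from `(x₁ … xₙ y) L` infer `(x₁ … xₙ) λy. L` -/
  | lam (n : ℕ) (L : Tm) (prem : Fin Rule.lam.arity → ProofTree) :
      (prem 0).concl = ⟨n + 1, L⟩ → IsUgDerivation (prem 0) →
      IsUgDerivation (node ⟨n, Tm.lam L⟩ Rule.lam prem)
  /-- from `(x₁ … xₙ) L₀` and `(x₁ … xₙ) L₁` infer `(x₁ … xₙ) L₀ L₁` -/
  | app (n : ℕ) (L₀ L₁ : Tm) (prem : Fin Rule.app.arity → ProofTree) :
      (prem 0).concl = ⟨n, L₀⟩ → (prem 1).concl = ⟨n, L₁⟩ →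
      IsUgDerivation (prem 0) → IsUgDerivation (prem 1) →
      IsUgDerivation (node ⟨n, Tm.app L₀ L₁⟩ Rule.app prem)
  /-- from `(x₁ … xₙ) L` infer `(x₁ … xₙ y) L`, if `y` does not occur in `L` -/
  | vac (n : ℕ) (L : Tm) (prem : Fin Rule.vac.arity → ProofTree) :
      (prem 0).concl = ⟨n, L⟩ → IsUgDerivation (prem 0) →
      IsUgDerivation (node ⟨n + 1, Tm.shift 1 L⟩ Rule.vac prem)
  /-- From `(x₁ … xₙ) Lⱼ[f₁ := c₁, …, fₖ := cₖ]` for `j = 1, …, k + 1` infer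
  `(x₁ … xₙ) letrec f₁ = L₁, …, fₖ = Lₖ in Lₖ₊₁`, and discharge the assumptions
  `((x₁ … xₙ) cᵢ)` with marker `uᵢ`. The hypotheses say, in this order: the constants are
  distinct; the markers are distinct; the constants are fresh for the equations and for the
  in-part; the premises have the right form; open assumptions with marker `uᵢ` in the immediate
  subderivations are of the form `(x₁ … xₙ) cᵢ`; conversely, the constant `cᵢ` does not occur in
  other open assumptions of the immediate subderivations; on threads from these assumptions
  downwards all abstraction prefixes have at least length `n`; the immediate subderivations are
  derivations. -/
  | fixLetrec (n k : ℕ) (B : Fin k → Tm) (L : Tm) (c u : Fin k → ℕ)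
      (prem : Fin (Rule.fixLetrec k c u).arity → ProofTree) :
      Function.Injective c → Function.Injective u →
      (∀ i j, ¬ (B j).HasConst (c i)) → (∀ i, ¬ L.HasConst (c i)) →
      (∀ i : Fin k, (prem i.castSucc).concl = ⟨n, (B i).instConsts c⟩) →
      (prem (Fin.last k)).concl = ⟨n, L.instConsts c⟩ →
      (∀ j i J, OpenAssumption (prem j) (u i) J → J = ⟨n, Tm.const (c i)⟩) →
      (∀ j i v m, OpenAssumption (prem j) v ⟨m, Tm.const (c i)⟩ → v = u i) →
      (∀ j i J, OnThread (prem j) (u i) J → n ≤ J.len) →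
      (∀ j, IsUgDerivation (prem j)) →
      IsUgDerivation (node ⟨n, Tm.letrec k B L⟩ (Rule.fixLetrec k c u) prem)

/-- The subtree at a position, if there is one: positions (formula occurrences) are lists of
numbers of premises, read from the conclusion upwards. -/
def sub : ProofTree → List ℕ → Option ProofTree
  | D, [] => some D
  | node _ r prem, i :: p => if h : i < r.arity then sub (prem ⟨i, h⟩) p else none

/-- At position `q` there is the conclusion of an instance of the rule for letrec whose marker
with number `i` is `v`. -/
def BindsAt (D : ProofTree) (q : List ℕ) (v i : ℕ) : Prop :=
  ∃ (J : Judgement) (k : ℕ) (c u : Fin k → ℕ) (prem : Fin (k + 1) → ProofTree) (j : Fin k),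
    D.sub q = some (node J (Rule.fixLetrec k c u) prem) ∧ u j = v ∧ (j : ℕ) = i

/-- The steps of access paths, between formula occurrences. -/
inductive AccessStep (D : ProofTree) : List ℕ → List ℕ → Prop
  /-- from the conclusion of an instance of a rule other than the rule for letrec to a premise -/
  | up {p : List ℕ} {E : ProofTree} (i : ℕ) : D.sub p = some E → ¬ E.rule.IsFix →
      i < E.rule.arity → AccessStep D p (p ++ [i])
  /-- from the conclusion of an instance of the rule for letrec to the rightmost premise -/
  | inPart {p : List ℕ} {E : ProofTree} {k : ℕ} {c u : Fin k → ℕ} : D.sub p = some E →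
      E.rule = Rule.fixLetrec k c u → AccessStep D p (p ++ [k])
  /-- from a marked assumption to the corresponding premise of the instance of the rule for letrec
  at which the assumption is discharged (the topmost one below it with this marker) -/
  | unfRec {p q : List ℕ} {E : ProofTree} {v i : ℕ} : D.sub p = some E →
      E.rule = Rule.hyp v → q <+: p → D.BindsAt q v i →
      (∀ q' i', q' <+: p → D.BindsAt q' v i' → q' <+: q) →
      AccessStep D p (q ++ [i])

/-- Access paths: they start at the conclusion. -/
def IsAccessPath (D : ProofTree) (π : List (List ℕ)) : Prop :=
  π.head? = some [] ∧ π.IsChain (AccessStep D)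

/-- At position `p` there is the conclusion of a guard. -/
def GuardAt (D : ProofTree) (p : List ℕ) : Prop :=
  ∃ E, D.sub p = some E ∧ E.rule.IsGuard

/-- Every access path contains, on each of its cycles (the segments between two visits of the same
formula occurrence `p`), at least one guard. -/
def GuardedOnAccessPathCycles (D : ProofTree) : Prop :=
  ∀ (π : List (List ℕ)) (p : List ℕ) (σ : List (List ℕ)),
    D.IsAccessPath (π ++ p :: σ ++ [p]) → ∃ q ∈ p :: σ, D.GuardAt q

/-- The side-condition on access path cycles: for every bottommost instance of the rule for letrec
the derivation that arises by it is guarded on access path cycles. -/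
inductive BottommostGuarded : ProofTree → Prop
  | fixLetrec {D : ProofTree} : D.rule.IsFix → D.GuardedOnAccessPathCycles → BottommostGuarded D
  | other {J : Judgement} {r : Rule} {prem : Fin r.arity → ProofTree} : ¬ r.IsFix →
      (∀ j, BottommostGuarded (prem j)) → BottommostGuarded (node J r prem)

/-- A derivation in the proof system, possibly with open assumptions. -/
def IsDerivation (D : ProofTree) : Prop := D.IsUgDerivation ∧ D.BottommostGuarded

/-- All assumptions are discharged. -/
def IsClosed (D : ProofTree) : Prop := ∀ v J, ¬ D.OpenAssumption v J

end ProofTree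

/-- Derivability: there is a closed derivation with the given conclusion. -/
def Derivable (J : Judgement) : Prop :=
  ∃ D : ProofTree, D.IsDerivation ∧ D.IsClosed ∧ D.concl = J

end LetrecUnf

/-!
Both sides of the equivalence are compared with a denotational semantics `Tm.depth`, which assigns
to a term its productive depth in `ℕ∞`: the least depth at which its unfolding is undefined. An
abstraction adds `1` to the depth of its body, an application adds `1` to the minimum of the depths
of its two parts, and a binding group denotes the least solution of its equations. A closed term
expresses an infinite term if and only if its productive depth is `⊤`, and it is derivable if and
only if its productive depth is `⊤`.

*Unfolding.* As the semantics is compositional, every unfolding step preserves the productive depth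
(`Tm.UnfStep.depth_eq`); the rule that merges binding groups is a case of Bekić's law. A term
that agrees with an infinite term up to depth `d` has productive depth at least `d`, which gives one
direction (`Expresses.depth_eq_top`). Conversely, the semantics is adequate (`Tm.adequate`): a term
of non-zero depth can be rewritten by root steps to a variable, an abstraction, or an application.
This follows from the least solution being below the assignment of `⊤` to those recursion variables
that have a head normal form and of `0` to all others. Iterating head normalization level by level
gives the infinite term and the strongly convergent sequence (`expresses_of_headStep`).

*Derivations.* Prooftrees have a productive depth that is defined by the same equations, and it is
equal to that of the conclusion (`ProofTree.IsUgDerivation.depth_eq`). It is also equal to the number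
of guards that all access paths have to pass unless they end (`ProofTree.depth_le_okDepth`,
`ProofTree.Ok.le_depth`). Since a prooftree has finitely many formula occurrences, this number is
infinite if and only if there is no unguarded cycle
(`ProofTree.guardedOnAccessPathCycles_iff`). So every derivation of a term of infinite productive
depth satisfies the side-condition on cycles, and it remains to note that every closed term has a
derivation without this side-condition (`ProofTree.exists_suitable`).
-/

namespace LetrecUnf

/-! ### Least prefixpoints and environments -/

/-- The least prefixpoint of a self-map of a complete lattice. For monotone maps it is the least
fixpoint; the unbundled form can be used in recursive definitions before monotonicity is known. -/
def leastPre {α : Type*} [CompleteLattice α] (f : α → α) : α := sInf {a | f a ≤ a}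

lemma leastPre_le {α : Type*} [CompleteLattice α] {f : α → α} {a : α} (h : f a ≤ a) :
    leastPre f ≤ a := sInf_le h

lemma map_leastPre {α : Type*} [CompleteLattice α] {f : α → α} (hf : Monotone f) :
    f (leastPre f) = leastPre f := OrderHom.map_lfp ⟨f, hf⟩

lemma leastPre_mono {α : Type*} [CompleteLattice α] {f g : α → α} (h : f ≤ g) :
    leastPre f ≤ leastPre g := sInf_le_sInf fun a ha => (h a).trans ha

/-- The environment `σ` under `k` additional binders with values `X`. -/
def extendEnv {α : Type*} {k : ℕ} (X : Fin k → α) (σ : ℕ → α) : ℕ → α :=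
  fun i => if h : i < k then X ⟨i, h⟩ else σ (i - k)

/-- Under `k` additional binders, a variable is one of the bound variables or a shifted outer
variable. -/
@[elab_as_elim]
lemma binder_cases {p : ℕ → Prop} (k : ℕ) (bound : ∀ i : Fin k, p i) (outer : ∀ i, p (i + k))
    (i : ℕ) : p i := by
  by_cases h : i < k
  · exact bound ⟨i, h⟩
  · have := outer (i - k)
    rwa [Nat.sub_add_cancel (not_lt.1 h)] at this

section extendEnv
variable {α : Type*} {k : ℕ} (X : Fin k → α) (σ : ℕ → α)

@[simp] lemma extendEnv_fin (i : Fin k) : extendEnv X σ i = X i := by simp [extendEnv]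

@[simp] lemma extendEnv_add (i : ℕ) : extendEnv X σ (i + k) = σ i := by simp [extendEnv]

lemma liftRen_fin (ρ : ℕ → ℕ) (i : Fin k) : Tm.liftRen k ρ i = i := by simp [Tm.liftRen]

lemma liftRen_add (k : ℕ) (ρ : ℕ → ℕ) (i : ℕ) : Tm.liftRen k ρ (i + k) = ρ i + k := by
  simp [Tm.liftRen]

lemma extendEnv_comp_liftRen (ρ : ℕ → ℕ) :
    extendEnv X σ ∘ Tm.liftRen k ρ = extendEnv X (σ ∘ ρ) := by
  funext i
  induction i using binder_cases k <;>
    simp [liftRen_fin, liftRen_add]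

lemma extendEnv_mono [Preorder α] {X Y : Fin k → α} {σ τ : ℕ → α} (h : X ≤ Y) (h' : σ ≤ τ) :
    extendEnv X σ ≤ extendEnv Y τ := by
  intro i
  induction i using binder_cases k with
  | bound i => simpa using h i
  | outer i => simpa using h' i

lemma extendEnv_const_top : extendEnv (fun _ : Fin k => (⊤ : ℕ∞)) ⊤ = ⊤ := by
  funext i; simp [extendEnv]

end extendEnv

/-! ### The productive depth of a term -/

namespace Tm

/-- The productive depth of a term: the least depth at which its unfolding is undefined, and `⊤`
if its unfolding is defined everywhere. Free variables take their values from `σ`, constants from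
`κ`, and a binding group denotes the least solution of its equations. -/
noncomputable def depth (κ : ℕ → ℕ∞) : Tm → (ℕ → ℕ∞) → ℕ∞
  | var i, σ => σ i
  | const c, _ => κ c
  | lam L, σ => depth κ L (extendEnv (fun _ : Fin 1 => ⊤) σ) + 1
  | app L₀ L₁, σ => min (depth κ L₀ σ) (depth κ L₁ σ) + 1
  | letrec k B L, σ =>
      depth κ L (extendEnv
        (leastPre fun (X : Fin k → ℕ∞) j => depth κ (B j) (extendEnv X σ)) σ)

/-- The productive depths of the recursion variables of a binding group. -/
noncomputable def depths (κ : ℕ → ℕ∞) {k : ℕ} (B : Fin k → Tm) (σ : ℕ → ℕ∞) : Fin k → ℕ∞ :=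
  leastPre fun X j => depth κ (B j) (extendEnv X σ)

variable {κ : ℕ → ℕ∞}

lemma depth_letrec (k : ℕ) (B : Fin k → Tm) (L : Tm) (σ : ℕ → ℕ∞) :
    depth κ (letrec k B L) σ = depth κ L (extendEnv (depths κ B σ) σ) := rfl

lemma depth_mono (L : Tm) : Monotone (depth κ L) := by
  induction L with
  | var i => exact fun σ τ h => h i
  | const c => exact fun σ τ h => le_rfl
  | lam L ih => exact fun σ τ h => add_le_add_left (ih (extendEnv_mono le_rfl h)) 1
  | app L₀ L₁ ih₀ ih₁ => exact fun σ τ h => add_le_add_left (min_le_min (ih₀ h) (ih₁ h)) 1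
  | letrec k B L ihB ih =>
    exact fun σ τ h => ih (extendEnv_mono
      (leastPre_mono fun X j => ihB j (extendEnv_mono le_rfl h)) h)

lemma depths_mono {k : ℕ} (B : Fin k → Tm) : Monotone (depths κ B) :=
  fun _ _ h => leastPre_mono fun _ j => depth_mono (B j) (extendEnv_mono le_rfl h)

lemma depth_depths {k : ℕ} (B : Fin k → Tm) (σ : ℕ → ℕ∞) (j : Fin k) :
    depth κ (B j) (extendEnv (depths κ B σ) σ) = depths κ B σ j :=
  congrFun (map_leastPre (f := fun (X : Fin k → ℕ∞) j => depth κ (B j) (extendEnv X σ))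
    fun _ _ h j => depth_mono (B j) (extendEnv_mono h le_rfl)) j

lemma depths_le {k : ℕ} {B : Fin k → Tm} {σ : ℕ → ℕ∞} {X : Fin k → ℕ∞}
    (h : ∀ j, depth κ (B j) (extendEnv X σ) ≤ X j) : depths κ B σ ≤ X :=
  leastPre_le h

lemma depth_rename (L : Tm) (ρ : ℕ → ℕ) (σ : ℕ → ℕ∞) :
    depth κ (rename ρ L) σ = depth κ L (σ ∘ ρ) := by
  induction L generalizing ρ σ with
  | var i => rfl
  | const c => rfl
  | lam L ih => simp only [rename, depth, ih, extendEnv_comp_liftRen]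
  | app L₀ L₁ ih₀ ih₁ => simp only [rename, depth, ih₀, ih₁]
  | letrec k B L ihB ih => simp only [rename, depth, ihB, ih, extendEnv_comp_liftRen]

lemma depth_shift (m : ℕ) (X : Fin m → ℕ∞) (L : Tm) (σ : ℕ → ℕ∞) :
    depth κ (shift m L) (extendEnv X σ) = depth κ L σ := by
  rw [shift, depth_rename]; congr 1; funext i; simp

/-! ### Invariance of the productive depth under unfolding -/

lemma extendEnv_append {k m : ℕ} (Y : Fin m → ℕ∞) (X : Fin k → ℕ∞) (σ : ℕ → ℕ∞) :
    extendEnv (fun i : Fin (m + k) => Fin.addCases Y X i) σ = extendEnv Y (extendEnv X σ) := by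
  funext i
  induction i using binder_cases m with
  | bound i =>
    rw [extendEnv_fin]
    simpa using extendEnv_fin (fun i : Fin (m + k) => Fin.addCases Y X i) σ (Fin.castAdd k i)
  | outer i =>
    rw [extendEnv_add]
    induction i using binder_cases k with
    | bound i =>
      rw [extendEnv_fin]
      have := extendEnv_fin (fun i : Fin (m + k) => Fin.addCases Y X i) σ (Fin.natAdd m i)
      simpa [add_comm] using this
    | outer i => rw [extendEnv_add, add_assoc, add_comm k m, extendEnv_add]

/-- The triangular case of Bekić's law: the equations of `B` do not refer to those of `C`. -/
lemma depths_append {k m : ℕ} (B : Fin k → Tm) (C : Fin m → Tm) (σ : ℕ → ℕ∞) :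
    depths κ (Fin.addCases C (fun j => shift m (B j)) : Fin (m + k) → Tm) σ =
      fun i => Fin.addCases (depths κ C (extendEnv (depths κ B σ) σ)) (depths κ B σ) i := by
  set A : Fin (m + k) → Tm := Fin.addCases C (fun j => shift m (B j)) with hA
  have hAC (j) : A (Fin.castAdd k j) = C j := by simp [hA]
  have hAB (j) : A (Fin.natAdd m j) = shift m (B j) := by simp [hA]
  apply le_antisymm
  · refine depths_le fun i => ?_
    rw [extendEnv_append]
    refine Fin.addCases (fun i => ?_) (fun i => ?_) i
    · rw [hAC, Fin.addCases_left, depth_depths]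
    · rw [hAB, depth_shift, Fin.addCases_right, depth_depths]
  · set Z := depths κ A σ with hZ
    set Y : Fin m → ℕ∞ := fun i => Z (Fin.castAdd k i) with hY
    set X : Fin k → ℕ∞ := fun i => Z (Fin.natAdd m i) with hX
    have hZ' : Z = fun i => Fin.addCases Y X i := by
      funext i
      refine Fin.addCases (fun i => ?_) (fun i => ?_) i <;> simp [hX, hY]
    have hZA (i) : depth κ (A i) (extendEnv Y (extendEnv X σ)) = Z i := by
      rw [← extendEnv_append, ← hZ', hZ, depth_depths]
    have h₁ : depths κ B σ ≤ X := depths_le fun j => by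
      have := hZA (Fin.natAdd m j)
      rw [hAB, depth_shift] at this
      exact this.le
    have h₂ : depths κ C (extendEnv (depths κ B σ) σ) ≤ Y :=
      (depths_mono C (extendEnv_mono h₁ le_rfl)).trans <| depths_le fun j => by
        have := hZA (Fin.castAdd k j)
        rw [hAC] at this
        exact this.le
    intro i
    refine Fin.addCases (fun i => ?_) (fun i => ?_) i
    · simpa using h₂ i
    · simpa using h₁ i

lemma extendEnv_comp_embedRen {k k' : ℕ} (e : Fin k' → Fin k) (X : Fin k → ℕ∞) (σ : ℕ → ℕ∞) :
    extendEnv X σ ∘ embedRen e = extendEnv (X ∘ e) σ := by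
  funext i
  induction i using binder_cases k' <;> simp [embedRen]

lemma depths_embed {k k' : ℕ} {e : Fin k' → Fin k} (he : Function.Injective e) {B : Fin k → Tm}
    {B' : Fin k' → Tm} (hB : ∀ j, B (e j) = rename (embedRen e) (B' j)) (σ : ℕ → ℕ∞) :
    depths κ B σ ∘ e = depths κ B' σ := by
  apply le_antisymm
  · -- equations outside the range of `e` are irrelevant, hence may be given the value `⊤`
    have h : depths κ B σ ≤ Function.extend e (depths κ B' σ) ⊤ := depths_le fun i => by
      by_cases hi : ∃ j, e j = i
      · obtain ⟨j, rfl⟩ := hi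
        rw [hB, depth_rename, extendEnv_comp_embedRen, Function.extend_comp he, depth_depths,
          he.extend_apply]
      · rw [Function.extend_apply' _ _ _ hi]; exact le_top
    intro j
    simpa [he.extend_apply] using h (e j)
  · refine depths_le fun j => ?_
    rw [← extendEnv_comp_embedRen, ← depth_rename, ← hB, depth_depths]; rfl

lemma UnfRule.depth_eq {L L' : Tm} (h : UnfRule L L') (σ : ℕ → ℕ∞) :
    depth κ L σ = depth κ L' σ := by
  cases h with
  | app k B L₀ L₁ => rfl
  | lam k B L =>
    have hB (X : Fin k → ℕ∞) (j : Fin k) :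
        depth κ (rename (liftRen k fun i => i + 1) (B j))
          (extendEnv X (extendEnv (fun _ : Fin 1 => ⊤) σ)) = depth κ (B j) (extendEnv X σ) := by
      rw [depth_rename, extendEnv_comp_liftRen]
      congr 2
    simp only [depth, depth_rename, hB]
    congr 2
    funext i
    rcases i with _ | i
    · simp [exchangeRen, extendEnv]
    · by_cases hi : i < k
      · simp [exchangeRen, extendEnv, hi]
      · have h1 : ¬ i + 1 ≤ k := by omega
        have h2 : ¬ i + 1 < k := by omega
        have h3 : i + 1 - k ≠ 0 := by omega
        have h4 : i + 1 - k - 1 = i - k := by omega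
        simp [exchangeRen, extendEnv, hi, h1, h2, h3, h4]
  | letrec k m B C L =>
    rw [depth_letrec, depth_letrec, depth_letrec, depths_append, extendEnv_append]
  | unfRec k B i =>
    rw [depth_letrec, depth_letrec, depth_depths]
    exact extendEnv_fin _ _ i
  | nil B L =>
    rw [depth_letrec]
    congr 1
  | reduce k k' e B B' L L' _ he _ hL hB =>
    rw [depth_letrec, depth_letrec, hL, depth_rename, extendEnv_comp_embedRen,
      depths_embed he.injective hB]

lemma UnfStep.depth_eq {d : ℕ} {L L' : Tm} (h : UnfStep d L L') (σ : ℕ → ℕ∞) :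
    depth κ L σ = depth κ L' σ := by
  induction h generalizing σ with
  | root h => exact h.depth_eq σ
  | lam _ ih => simp only [depth, ih]
  | appLeft P _ ih => simp only [depth, ih]
  | appRight P _ ih => simp only [depth, ih]
  | @letrecDef d k B j L' P _ ih =>
    have h (i) : depth κ (Function.update B j L' i) = depth κ (B i) := by
      rcases eq_or_ne i j with rfl | hij
      · rw [Function.update_self]; exact funext fun σ => (ih σ).symm
      · rw [Function.update_of_ne hij]
    simp only [depth, h]
  | letrecBody B _ ih => exact ih _

end Tm

lemma AgreesUpTo.le_depth {d : ℕ} {L : Tm} {M : InfTm} (h : AgreesUpTo d L M) :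
    (d : ℕ∞) ≤ L.depth ⊤ ⊤ := by
  induction h with
  | zero => simp
  | var d i => exact le_top
  | lam _ ih =>
    push_cast
    rw [Tm.depth, extendEnv_const_top]
    exact add_le_add_left ih 1
  | app _ _ ih₀ ih₁ =>
    push_cast
    exact add_le_add_left (le_min ih₀ ih₁) 1

/-- Unfolding preserves the productive depth, and the terms of a converging sequence have
arbitrarily large productive depth. -/
lemma Expresses.depth_eq_top {L : Tm} {M : InfTm} (h : Expresses L M) : L.depth ⊤ ⊤ = ⊤ := by
  obtain ⟨s, δ, rfl, hs, -, hM⟩ := h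
  have hd (n : ℕ) : (s n).depth ⊤ ⊤ = (s 0).depth ⊤ ⊤ := by
    induction n with
    | zero => rfl
    | succ n ih =>
      rcases hs n with h | h
      · rw [h, ih]
      · rw [← h.depth_eq, ih]
  refine ENat.eq_top_iff_forall_ge.2 fun d => ?_
  obtain ⟨n, hn⟩ := (hM d).exists
  exact hn.le_depth.trans (hd n).le

/-! ### The productive depth of a prooftree -/

namespace ProofTree

/-- The environment `μ`, in which the markers `u i` are given the values `X i`. If a marker is
listed repeatedly, as it can be in an incorrect prooftree, it is given the least of these values. -/
noncomputable def updateMarkers {k : ℕ} (μ : ℕ → ℕ∞) (u : Fin k → ℕ) (X : Fin k → ℕ∞) : ℕ → ℕ∞ :=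
  fun v => open scoped Classical in if ∃ i, u i = v then ⨅ (i) (_ : u i = v), X i else μ v

lemma updateMarkers_mono {k : ℕ} {μ ν : ℕ → ℕ∞} (u : Fin k → ℕ) {X Y : Fin k → ℕ∞} (h : μ ≤ ν)
    (h' : X ≤ Y) : updateMarkers μ u X ≤ updateMarkers ν u Y := by
  intro v
  simp only [updateMarkers]
  split_ifs
  · exact iInf₂_mono fun i _ => h' i
  · exact h v

lemma updateMarkers_apply {k : ℕ} (μ : ℕ → ℕ∞) {u : Fin k → ℕ} (hu : Function.Injective u)
    (X : Fin k → ℕ∞) (i : Fin k) : updateMarkers μ u X (u i) = X i := by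
  rw [updateMarkers, if_pos ⟨i, rfl⟩]
  exact le_antisymm (iInf₂_le (f := fun j (_ : u j = u i) => X j) i rfl) (le_iInf₂ fun j hj => (congrArg X (hu hj)).ge)

lemma updateMarkers_of_forall_ne {k : ℕ} (μ : ℕ → ℕ∞) {u : Fin k → ℕ} (X : Fin k → ℕ∞) {v : ℕ}
    (hv : ∀ i, u i ≠ v) : updateMarkers μ u X v = μ v :=
  if_neg fun ⟨i, hi⟩ => hv i hi

/-- The productive depth of a prooftree: abstractions and applications are productive, and an
instance of the rule for letrec denotes the least solution of the equations that are given by its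
premises. Marked assumptions take their values from `μ`. -/
noncomputable def depth : ProofTree → (ℕ → ℕ∞) → ℕ∞
  | node _ (Rule.hyp v) _, μ => μ v
  | node _ Rule.nlvar _, _ => ⊤
  | node _ Rule.lam prem, μ => depth (prem 0) μ + 1
  | node _ Rule.app prem, μ => min (depth (prem 0) μ) (depth (prem 1) μ) + 1
  | node _ Rule.vac prem, μ => depth (prem 0) μ
  | node _ (Rule.fixLetrec k _ u) prem, μ =>
      depth (prem (Fin.last k)) (updateMarkers μ u
        (leastPre fun X i => depth (prem (Fin.castSucc i)) (updateMarkers μ u X)))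

/-- The productive depths of the premises for the equations at an instance of the rule for
letrec. -/
noncomputable def depths {k : ℕ} (u : Fin k → ℕ) (prem : Fin (k + 1) → ProofTree) (μ : ℕ → ℕ∞) :
    Fin k → ℕ∞ :=
  leastPre fun X i => depth (prem (Fin.castSucc i)) (updateMarkers μ u X)

lemma depth_fix (J : Judgement) (k : ℕ) (c u : Fin k → ℕ) (prem : Fin (k + 1) → ProofTree)
    (μ : ℕ → ℕ∞) : depth (node J (Rule.fixLetrec k c u) prem) μ =
      depth (prem (Fin.last k)) (updateMarkers μ u (depths u prem μ)) := rfl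

lemma depth_mono (D : ProofTree) : Monotone D.depth := by
  induction D with
  | node J r prem ih =>
    intro μ ν h
    cases r with
    | hyp v => exact h v
    | nlvar => exact le_rfl
    | lam => exact add_le_add_left (ih 0 h) 1
    | app => exact add_le_add_left (min_le_min (ih 0 h) (ih 1 h)) 1
    | vac => exact ih 0 h
    | fixLetrec k c u =>
      exact ih (Fin.last k) (updateMarkers_mono u h
        (leastPre_mono fun _ i => ih i.castSucc (updateMarkers_mono u h le_rfl)))

lemma depth_depths {k : ℕ} (u : Fin k → ℕ) (prem : Fin (k + 1) → ProofTree) (μ : ℕ → ℕ∞)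
    (i : Fin k) : depth (prem i.castSucc) (updateMarkers μ u (depths u prem μ)) =
      depths u prem μ i :=
  congrFun (map_leastPre
    (f := fun (X : Fin k → ℕ∞) i => depth (prem i.castSucc) (updateMarkers μ u X))
    fun _ _ h _ => depth_mono _ (updateMarkers_mono u le_rfl h)) i

end ProofTree

/-! ### Prooftrees and their conclusions have the same productive depth -/

namespace Tm

lemma depth_congr_const {L : Tm} {κ κ' : ℕ → ℕ∞} (h : ∀ c, L.HasConst c → κ c = κ' c) :
    L.depth κ = L.depth κ' := by
  induction L with
  | var i => rfl
  | const c => exact funext fun _ => h c rfl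
  | lam L ih => funext σ; simp only [depth, ih h]
  | app L₀ L₁ ih₀ ih₁ =>
    funext σ
    simp only [depth, ih₀ fun c hc => h c (Or.inl hc), ih₁ fun c hc => h c (Or.inr hc)]
  | letrec k B L ihB ih =>
    funext σ
    have hB j := ihB j fun c hc => h c (Or.inl ⟨j, hc⟩)
    simp only [depth, ih fun c hc => h c (Or.inr hc), hB]

lemma depth_instConstsAux {k : ℕ} (c : Fin k → ℕ) {κ : ℕ → ℕ∞} (L : Tm) :
    ∀ (d : ℕ) (X : Fin d → ℕ∞) (σ : ℕ → ℕ∞), depth κ (instConstsAux c d L) (extendEnv X σ) =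
      depth κ L (extendEnv X (extendEnv (κ ∘ c) σ)) := by
  -- two layers of binders are a single one, to which the induction hypothesis applies
  have assoc {d m : ℕ} (Y : Fin m → ℕ∞) (X : Fin d → ℕ∞) (σ : ℕ → ℕ∞) :
      ∃ Z : Fin (d + m) → ℕ∞, ∀ σ, extendEnv Y (extendEnv X σ) = extendEnv Z σ := by
    refine ⟨fun i => Fin.addCases Y X (Fin.cast (add_comm d m) i), fun σ => ?_⟩
    rw [← extendEnv_append]
    funext i
    simp [extendEnv, add_comm m d]
  induction L with
  | var i =>
    intro d X σ
    induction i using binder_cases d with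
    | bound i => simp [instConstsAux, depth]
    | outer i =>
      induction i using binder_cases k with
      | bound i => simp [instConstsAux, depth]
      | outer i =>
        have h : i + k + d - k = i + d := by omega
        simp [instConstsAux, depth, h]
  | const c => intros; rfl
  | lam L ih =>
    intro d X σ
    obtain ⟨Z, hZ⟩ := assoc (fun _ : Fin 1 => ⊤) X σ
    simp only [instConstsAux, depth, hZ, ih]
  | app L₀ L₁ ih₀ ih₁ => intro d X σ; simp only [instConstsAux, depth, ih₀, ih₁]
  | letrec m B L ihB ih =>
    intro d X σ
    have h (L : Tm) (ih : ∀ (d : ℕ) (X : Fin d → ℕ∞) (σ : ℕ → ℕ∞),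
        depth κ (instConstsAux c d L) (extendEnv X σ) =
          depth κ L (extendEnv X (extendEnv (κ ∘ c) σ))) (Y : Fin m → ℕ∞) :
        depth κ (instConstsAux c (d + m) L) (extendEnv Y (extendEnv X σ)) =
          depth κ L (extendEnv Y (extendEnv X (extendEnv (κ ∘ c) σ))) := by
      obtain ⟨Z, hZ⟩ := assoc Y X σ
      rw [hZ, hZ, ih]
    simp only [instConstsAux, depth, h L ih, h (B _) (ihB _)]

lemma depth_instConsts {k : ℕ} (c : Fin k → ℕ) {κ : ℕ → ℕ∞} (L : Tm) (σ : ℕ → ℕ∞) :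
    depth κ (instConsts c L) σ = depth κ L (extendEnv (κ ∘ c) σ) := by
  have h (σ : ℕ → ℕ∞) : extendEnv (Fin.elim0 : Fin 0 → ℕ∞) σ = σ := by
    funext i; simp [extendEnv]
  simpa [h, instConsts] using depth_instConstsAux c (κ := κ) L 0 Fin.elim0 σ

end Tm

namespace ProofTree

lemma IsUgDerivation.openAssumption {D : ProofTree} (h : D.IsUgDerivation) {v : ℕ} {J : Judgement}
    (ho : D.OpenAssumption v J) : ∃ n c, J = ⟨n, Tm.const c⟩ := by
  induction ho with
  | hyp J v prem => cases h; exact ⟨_, _, rfl⟩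
  | step j _ _ ih =>
    cases h with
    | hyp => exact j.elim0
    | nlvar => exact j.elim0
    | lam n L prem _ h => exact ih ((Subsingleton.elim j 0) ▸ h)
    | app n L₀ L₁ prem _ _ h₀ h₁ =>
      refine ih ?_
      match j with
      | 0 => exact h₀
      | 1 => exact h₁
    | vac n L prem _ h => exact ih ((Subsingleton.elim j 0) ▸ h)
    | fixLetrec n k B L c u prem _ _ _ _ _ _ _ _ _ h => exact ih (h j)

/-- The productive depth of a derivation is that of its conclusion, if the values of the markers
agree with those of the assumed constants. -/
theorem IsUgDerivation.depth_eq {D : ProofTree} (h : D.IsUgDerivation) {μ κ : ℕ → ℕ∞}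
    (hμ : ∀ v n c, D.OpenAssumption v ⟨n, Tm.const c⟩ → μ v = κ c) :
    D.depth μ = D.concl.tm.depth κ ⊤ := by
  induction h generalizing μ κ with
  | hyp n c v prem => exact hμ _ _ _ (OpenAssumption.hyp _ v prem)
  | nlvar => rfl
  | lam n L prem h₀ _ ih =>
    simp only [depth, concl, Tm.depth, extendEnv_const_top]
    rw [ih (κ := κ) fun v n c h => hμ v n c (.step 0 id h), h₀]
  | app n L₀ L₁ prem h₀ h₁ _ _ ih₀ ih₁ =>
    simp only [depth, concl, Tm.depth]
    rw [ih₀ (κ := κ) fun v n c h => hμ v n c (.step 0 id h),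
      ih₁ (κ := κ) fun v n c h => hμ v n c (.step 1 id h), h₀, h₁]
  | vac n L prem h₀ _ ih =>
    simp only [depth, concl]
    rw [ih (κ := κ) fun v n c h => hμ v n c (.step 0 id h), h₀, Tm.shift, Tm.depth_rename]
    rfl
  | fixLetrec n k B L c u prem hc hu hB hL hpB hpL hou hoc _ hD ih =>
    -- the values of the constants when those of the recursion variables are `X`
    let κ' (X : Fin k → ℕ∞) : ℕ → ℕ∞ := updateMarkers κ c X
    have key (X : Fin k → ℕ∞) (j) (P : Tm) (hP : ∀ i, ¬ P.HasConst (c i))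
        (hj : (prem j).concl = ⟨n, P.instConsts c⟩) :
        (prem j).depth (updateMarkers μ u X) = P.depth κ (extendEnv X ⊤) := by
      rw [ih j (κ := κ' X), hj, Tm.depth_instConsts]
      · have h₁ : κ' X ∘ c = X := funext fun i => updateMarkers_apply κ hc X i
        rw [h₁, Tm.depth_congr_const (κ' := κ)]
        intro a ha
        exact updateMarkers_of_forall_ne _ _ fun i hi => hP i (hi ▸ ha)
      · intro v m a hva
        by_cases hv : ∃ i, u i = v
        · obtain ⟨i, rfl⟩ := hv
          have := hou j i _ hva
          simp only [Judgement.mk.injEq, Tm.const.injEq] at this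
          rw [this.2, updateMarkers_apply μ hu]
          exact (updateMarkers_apply κ hc X i).symm
        · rw [updateMarkers_of_forall_ne _ _ fun i hi => hv ⟨i, hi⟩,
            hμ v m a (.step j hv hva)]
          refine (updateMarkers_of_forall_ne _ _ fun i hi => hv ⟨i, ?_⟩).symm
          subst hi
          exact (hoc j i v m hva).symm
    have hd : depths u prem μ = Tm.depths κ B ⊤ := by
      rw [depths, Tm.depths]
      congr 1
      funext X i
      exact key X _ _ (fun i' => hB i' i) (hpB i)
    rw [depth_fix, key _ _ L hL hpL, hd]
    rfl

/-! ### Access paths and the productive depth -/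

variable (D : ProofTree)

/-- `Ok D d p`: all access paths from the formula occurrence `p` either end or pass at least `d`
guards. -/
inductive Ok : ℕ → List ℕ → Prop
  | zero (p : List ℕ) : Ok 0 p
  | guard {d : ℕ} {p : List ℕ} : D.GuardAt p → (∀ p', D.AccessStep p p' → Ok d p') →
      Ok (d + 1) p
  | step {d : ℕ} {p : List ℕ} : ¬ D.GuardAt p → (∀ p', D.AccessStep p p' → Ok (d + 1) p') →
      Ok (d + 1) p

/-- `Target D p v w`: an assumption with marker `v` above `p` is discharged below `p`, and `w` is
the occurrence of the corresponding premise. -/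
def Target (p : List ℕ) (v : ℕ) (w : List ℕ) : Prop :=
  ∃ q i, q <+: p ∧ q ≠ p ∧ D.BindsAt q v i ∧
    (∀ q' i', q' <+: p → q' ≠ p → D.BindsAt q' v i' → q' <+: q) ∧ w = q ++ [i]

variable {D}

lemma Ok.pred {d : ℕ} {p : List ℕ} (h : D.Ok (d + 1) p) : D.Ok d p := by
  obtain ⟨e, he⟩ : ∃ e, e = d + 1 := ⟨_, rfl⟩
  rw [← he] at h
  induction h generalizing d with
  | zero => simp at he
  | guard hp _ ih =>
    rcases d with _ | d
    · exact .zero _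
    · exact .guard hp fun p' hp' => ih p' hp' (by simpa using he)
  | step hp _ ih =>
    rcases d with _ | d
    · exact .zero _
    · exact .step hp fun p' hp' => ih p' hp' (by simpa using he)

lemma Ok.mono {d e : ℕ} {p : List ℕ} (hde : d ≤ e) (h : D.Ok e p) : D.Ok d p := by
  induction e, hde using Nat.le_induction with
  | base => exact h
  | succ e _ ih => exact ih h.pred

variable (D) in
/-- The largest number of guards that all access paths from `p` are bound to pass, unless they
end. -/
noncomputable def okDepth (p : List ℕ) : ℕ∞ := ⨆ (d : ℕ) (_ : D.Ok d p), (d : ℕ∞)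

lemma le_okDepth {d : ℕ} {p : List ℕ} : (d : ℕ∞) ≤ D.okDepth p ↔ D.Ok d p := by
  refine ⟨fun h => ?_, fun h => le_iSup₂ (f := fun (d : ℕ) (_ : D.Ok d p) => (d : ℕ∞)) d h⟩
  rcases d with _ | d
  · exact .zero p
  · by_contra hd
    refine absurd (h.trans (b := D.okDepth p) (iSup₂_le (a := (d : ℕ∞)) fun e he => ?_)) (by
      exact_mod_cast Nat.not_succ_le_self d)
    by_contra hlt
    exact hd (he.mono (by exact_mod_cast not_le.1 hlt))

lemma sub_append (D : ProofTree) (p q : List ℕ) : D.sub (p ++ q) = (D.sub p).bind (sub · q) := by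
  induction p generalizing D with
  | nil => cases D; simp [sub]
  | cons i p ih =>
    obtain ⟨J, r, prem⟩ := D
    simp only [List.cons_append, sub]
    split_ifs
    · exact ih _
    · rfl

lemma sub_snoc {p : List ℕ} {J : Judgement} {r : Rule} {prem : Fin r.arity → ProofTree}
    (h : D.sub p = some (node J r prem)) (j : Fin r.arity) :
    D.sub (p ++ [(j : ℕ)]) = some (prem j) := by
  simp [sub_append, h, sub]

lemma guardAt_iff {p : List ℕ} {E : ProofTree} (h : D.sub p = some E) :
    D.GuardAt p ↔ E.rule.IsGuard := by
  simp [GuardAt, h]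

lemma accessStep_hyp_iff {p w : List ℕ} {E : ProofTree} {v : ℕ} (h : D.sub p = some E)
    (hr : E.rule = Rule.hyp v) : D.AccessStep p w ↔ D.Target p v w := by
  have hne {q : List ℕ} {v' i : ℕ} (hq : D.BindsAt q v' i) : q ≠ p := by
    rintro rfl
    obtain ⟨J, k, c, u, prem, j, hs, -⟩ := hq
    rw [h, Option.some_inj] at hs
    subst hs
    simp [rule] at hr
  constructor
  · intro hs
    cases hs with
    | up i hs _ hi =>
      rw [h, Option.some_inj] at hs
      subst hs
      rw [hr] at hi
      simp at hi
    | inPart hs hr' =>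
      rw [h, Option.some_inj] at hs
      subst hs
      simp [hr] at hr'
    | unfRec hs hr' hq hb hm =>
      rw [h, Option.some_inj] at hs
      subst hs
      rw [hr, Rule.hyp.injEq] at hr'
      subst hr'
      exact ⟨_, _, hq, hne hb, hb, fun q' i' h₁ _ h₂ => hm q' i' h₁ h₂, rfl⟩
  · rintro ⟨q, i, hq, -, hb, hm, rfl⟩
    exact .unfRec h hr hq hb fun q' i' h₁ h₂ => hm q' i' h₁ (hne h₂) h₂

lemma accessStep_of_not_fix {p w : List ℕ} {E : ProofTree} (h : D.sub p = some E)
    (hr : ¬ E.rule.IsFix) (hh : ∀ v, E.rule ≠ Rule.hyp v) (hs : D.AccessStep p w) :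
    ∃ i < E.rule.arity, w = p ++ [i] := by
  cases hs with
  | up i hs _ hi =>
    rw [h, Option.some_inj] at hs
    subst hs
    exact ⟨i, hi, rfl⟩
  | inPart hs hr' =>
    rw [h, Option.some_inj] at hs
    subst hs
    simp [hr', Rule.IsFix] at hr
  | unfRec hs hr' =>
    rw [h, Option.some_inj] at hs
    subst hs
    exact absurd hr' (hh _)

lemma accessStep_fix {p w : List ℕ} {J : Judgement} {k : ℕ} {c u : Fin k → ℕ}
    {prem : Fin (k + 1) → ProofTree} (h : D.sub p = some (node J (Rule.fixLetrec k c u) prem))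
    (hs : D.AccessStep p w) : w = p ++ [k] := by
  cases hs with
  | up i hs hr hi =>
    rw [h, Option.some_inj] at hs
    subst hs
    simp [rule, Rule.IsFix] at hr
  | inPart hs hr' =>
    rw [h, Option.some_inj] at hs
    subst hs
    simp only [rule, Rule.fixLetrec.injEq] at hr'
    rw [hr'.1]
  | unfRec hs hr' =>
    rw [h, Option.some_inj] at hs
    subst hs
    simp [rule] at hr'

lemma prefix_snoc_iff {q p : List ℕ} {j : ℕ} :
    q <+: p ++ [j] ∧ q ≠ p ++ [j] ↔ q = p ∨ q <+: p ∧ q ≠ p := by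
  rw [List.prefix_concat_iff]
  constructor
  · rintro ⟨rfl | h, hn⟩
    · exact absurd rfl hn
    · exact or_iff_not_imp_left.2 fun hq => ⟨h, hq⟩
  · rintro (rfl | ⟨h, -⟩)
    · simp
    · refine ⟨.inr h, ?_⟩
      rintro rfl
      simpa using h.length_le

lemma not_bindsAt {p : List ℕ} {E : ProofTree} (h : D.sub p = some E) {v : ℕ}
    (hr : ¬ E.rule.Discharges v) (i : ℕ) : ¬ D.BindsAt p v i := by
  rintro ⟨J, k, c, u, prem, j, hs, hj, -⟩
  rw [h, Option.some_inj] at hs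
  subst hs
  exact hr ⟨j, hj⟩

lemma target_snoc_of_not_discharges {p : List ℕ} {E : ProofTree} (h : D.sub p = some E) {v : ℕ}
    (hr : ¬ E.rule.Discharges v) (j : ℕ) (w : List ℕ) :
    D.Target (p ++ [j]) v w ↔ D.Target p v w := by
  have hp := not_bindsAt h hr
  have hiff {q : List ℕ} {i : ℕ} :
      (q <+: p ++ [j] ∧ q ≠ p ++ [j] ∧ D.BindsAt q v i) ↔
        (q <+: p ∧ q ≠ p ∧ D.BindsAt q v i) := by
    rw [← and_assoc, ← and_assoc, prefix_snoc_iff]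
    constructor
    · rintro ⟨rfl | h, hb⟩
      · exact absurd hb (hp _)
      · exact ⟨h, hb⟩
    · exact fun ⟨h, hb⟩ => ⟨.inr h, hb⟩
  constructor
  · rintro ⟨q, i, h₁, h₂, h₃, h₄, h₅⟩
    obtain ⟨h₁, h₂, h₃⟩ := hiff.1 ⟨h₁, h₂, h₃⟩
    refine ⟨q, i, h₁, h₂, h₃, fun q' i' k₁ k₂ k₃ => ?_, h₅⟩
    obtain ⟨k₁, k₂, k₃⟩ := hiff.2 ⟨k₁, k₂, k₃⟩
    exact h₄ q' i' k₁ k₂ k₃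
  · rintro ⟨q, i, h₁, h₂, h₃, h₄, h₅⟩
    obtain ⟨h₁, h₂, h₃⟩ := hiff.2 ⟨h₁, h₂, h₃⟩
    refine ⟨q, i, h₁, h₂, h₃, fun q' i' k₁ k₂ k₃ => ?_, h₅⟩
    obtain ⟨k₁, k₂, k₃⟩ := hiff.1 ⟨k₁, k₂, k₃⟩
    exact h₄ q' i' k₁ k₂ k₃

lemma target_snoc_of_discharges {p : List ℕ} {J : Judgement} {k : ℕ} {c u : Fin k → ℕ}
    {prem : Fin (k + 1) → ProofTree} (h : D.sub p = some (node J (Rule.fixLetrec k c u) prem))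
    {v : ℕ} (hv : ∃ i, u i = v) (j : ℕ) (w : List ℕ) :
    D.Target (p ++ [j]) v w ↔ ∃ i, u i = v ∧ w = p ++ [(i : ℕ)] := by
  constructor
  · rintro ⟨q, i, h₁, h₂, h₃, h₄, rfl⟩
    obtain ⟨l, hl⟩ := hv
    have hpq : p <+: q := h₄ p l (by simp) (by simp) ⟨J, k, c, u, prem, l, h, hl, rfl⟩
    have hqp : q = p := by
      rcases prefix_snoc_iff.1 ⟨h₁, h₂⟩ with rfl | ⟨h, -⟩
      · rfl
      · exact h.eq_of_length_le hpq.length_le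
    subst hqp
    obtain ⟨J', k', c', u', prem', i', hs, hv', rfl⟩ := h₃
    rw [h, Option.some_inj] at hs
    cases hs
    exact ⟨i', hv', rfl⟩
  · rintro ⟨i, hi, rfl⟩
    refine ⟨p, i, by simp, by simp, ⟨J, k, c, u, prem, i, h, hi, rfl⟩, fun q' i' h₁ h₂ _ => ?_, rfl⟩
    rcases prefix_snoc_iff.1 ⟨h₁, h₂⟩ with rfl | ⟨h, -⟩
    · exact List.prefix_rfl
    · exact h

variable (D) in
/-- The marker environment at the occurrence `p` that is read off from the access paths. -/
noncomputable def targetEnv (p : List ℕ) : ℕ → ℕ∞ :=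
  fun v => ⨅ (w) (_ : D.Target p v w), D.okDepth w

lemma targetEnv_snoc_of_not_fix {p : List ℕ} {E : ProofTree} (h : D.sub p = some E)
    (hr : ∀ v, ¬ E.rule.Discharges v) (j : ℕ) : D.targetEnv (p ++ [j]) = D.targetEnv p := by
  funext v
  simp only [targetEnv, target_snoc_of_not_discharges h (hr v)]

lemma targetEnv_snoc_fix {p : List ℕ} {J : Judgement} {k : ℕ} {c u : Fin k → ℕ}
    {prem : Fin (k + 1) → ProofTree} (h : D.sub p = some (node J (Rule.fixLetrec k c u) prem))
    (j : ℕ) : D.targetEnv (p ++ [j]) =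
      updateMarkers (D.targetEnv p) u fun i => D.okDepth (p ++ [(i : ℕ)]) := by
  funext v
  by_cases hv : ∃ i, u i = v
  · rw [updateMarkers, if_pos hv]
    simp only [targetEnv, target_snoc_of_discharges h hv]
    apply le_antisymm
    · exact le_iInf₂ fun i hi => iInf₂_le (f := fun w _ => D.okDepth w) _ ⟨i, hi, rfl⟩
    · refine le_iInf₂ fun w hw => ?_
      obtain ⟨i, hi, rfl⟩ := hw
      exact iInf₂_le (f := fun (i : Fin k) (_ : u i = v) => D.okDepth (p ++ [(i : ℕ)])) i hi
  · rw [updateMarkers, if_neg hv]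
    simp only [targetEnv, target_snoc_of_not_discharges h (v := v) (fun hv' => hv hv')]

/-- The numbers `okDepth` solve the equations of the subtrees up to inequality, so they bound the
least solution from above. -/
lemma depth_le_okDepth (E : ProofTree) {p : List ℕ} (h : D.sub p = some E) :
    E.depth (D.targetEnv p) ≤ D.okDepth p := by
  induction E generalizing p with
  | node J r prem ih =>
    have hg := guardAt_iff h
    have ih' (j : Fin r.arity) := ih j (sub_snoc h j)
    refine ENat.forall_natCast_le_iff_le.1 fun d hd => le_okDepth.2 ?_
    rcases d with _ | d
    · exact .zero p
    cases r with
    | hyp v =>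
      refine .step (fun hp => hg.1 hp) fun w hw => le_okDepth.1 (hd.trans ?_)
      exact iInf₂_le (f := fun w _ => D.okDepth w) w ((accessStep_hyp_iff h rfl).1 hw)
    | nlvar =>
      refine .step (fun hp => hg.1 hp) fun w hw => ?_
      obtain ⟨i, hi, -⟩ := accessStep_of_not_fix h id (fun _ => nofun) hw
      simp [rule] at hi
    | lam =>
      refine .guard (hg.2 trivial) fun w hw => le_okDepth.1 ?_
      obtain ⟨i, hi, rfl⟩ := accessStep_of_not_fix h id (fun _ => nofun) hw
      have h0 := ih' ⟨i, hi⟩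
      rw [targetEnv_snoc_of_not_fix h (fun _ => id)] at h0
      refine le_trans ?_ h0
      obtain rfl : i = 0 := by simpa [rule] using hi
      simp only [depth] at hd
      push_cast at hd
      exact (ENat.add_le_add_iff_right (by simp)).1 hd
    | app =>
      refine .guard (hg.2 trivial) fun w hw => le_okDepth.1 ?_
      obtain ⟨i, hi, rfl⟩ := accessStep_of_not_fix h id (fun _ => nofun) hw
      have h0 := ih' ⟨i, hi⟩
      rw [targetEnv_snoc_of_not_fix h (fun _ => id)] at h0
      refine le_trans ?_ h0
      simp only [depth] at hd
      push_cast at hd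
      have hd' := le_min_iff.1 ((ENat.add_le_add_iff_right (by simp)).1 hd)
      match i, hi with
      | 0, _ => exact hd'.1
      | 1, _ => exact hd'.2
    | vac =>
      refine .step (fun hp => hg.1 hp) fun w hw => le_okDepth.1 (hd.trans ?_)
      obtain ⟨i, hi, rfl⟩ := accessStep_of_not_fix h id (fun _ => nofun) hw
      have h0 := ih' ⟨i, hi⟩
      rw [targetEnv_snoc_of_not_fix h (fun _ => id)] at h0
      obtain rfl : i = 0 := by simpa [rule] using hi
      exact h0
    | fixLetrec k c u =>
      refine .step (fun hp => hg.1 hp) fun w hw => le_okDepth.1 (hd.trans ?_)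
      obtain rfl := accessStep_fix h hw
      have hX : depths u prem (D.targetEnv p) ≤ fun i : Fin k => D.okDepth (p ++ [(i : ℕ)]) :=
        leastPre_le fun i => by
          have := ih' i.castSucc
          rwa [targetEnv_snoc_fix h] at this
      have hl := ih' (Fin.last k)
      rw [targetEnv_snoc_fix h] at hl
      exact (depth_mono _ (updateMarkers_mono u le_rfl hX)).trans hl

variable (D) in
/-- `At D p E μ`: at position `p` of `D` there is the subtree `E`, and `μ` is the marker environment
that arises there by solving the equations of the instances of the rule for letrec below. -/
inductive At : List ℕ → ProofTree → (ℕ → ℕ∞) → Prop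
  | root : At [] D ⊤
  | other {p : List ℕ} {J : Judgement} {r : Rule} {prem : Fin r.arity → ProofTree} {μ : ℕ → ℕ∞}
      (j : Fin r.arity) : ¬ r.IsFix → At p (node J r prem) μ → At (p ++ [(j : ℕ)]) (prem j) μ
  | fix {p : List ℕ} {J : Judgement} {k : ℕ} {c u : Fin k → ℕ} {prem : Fin (k + 1) → ProofTree}
      {μ : ℕ → ℕ∞} (j : Fin (k + 1)) : At p (node J (Rule.fixLetrec k c u) prem) μ →
      At (p ++ [(j : ℕ)]) (prem j) (updateMarkers μ u (depths u prem μ))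

lemma At.sub {p : List ℕ} {E : ProofTree} {μ : ℕ → ℕ∞} (h : D.At p E μ) : D.sub p = some E := by
  induction h with
  | root => simp [ProofTree.sub]
  | other j _ _ ih => exact sub_snoc ih j
  | fix j _ ih => exact sub_snoc ih j

lemma At.le_marker {p : List ℕ} {E : ProofTree} {μ : ℕ → ℕ∞} (h : D.At p E μ) {v : ℕ} {x : ℕ∞}
    (hx : ∀ w F ν, D.Target p v w → D.At w F ν → x ≤ F.depth ν) : x ≤ μ v := by
  induction h with
  | root => exact le_top
  | @other p J r prem μ j hr h ih =>
    have hd : ¬ (node J r prem).rule.Discharges v := by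
      cases r with
      | fixLetrec => exact absurd trivial hr
      | _ => exact id
    exact ih fun w F ν hw => hx w F ν ((target_snoc_of_not_discharges h.sub hd _ _).2 hw)
  | @fix p J k c u prem μ j h ih =>
    by_cases hv : ∃ i, u i = v
    · rw [updateMarkers, if_pos hv]
      refine le_iInf₂ fun i hi => ?_
      rw [← depth_depths]
      exact hx _ _ _ ((target_snoc_of_discharges h.sub hv _ _).2 ⟨i, hi, rfl⟩) (h.fix i.castSucc)
    · rw [updateMarkers, if_neg hv]
      exact ih fun w F ν hw => hx w F ν ((target_snoc_of_not_discharges h.sub hv _ _).2 hw)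

lemma Ok.le_depth {d : ℕ} {p : List ℕ} (h : D.Ok d p) {E : ProofTree} {μ : ℕ → ℕ∞}
    (hE : D.At p E μ) : (d : ℕ∞) ≤ E.depth μ := by
  induction h generalizing E μ with
  | zero => simp
  | guard hg _ ih =>
    rw [guardAt_iff hE.sub] at hg
    obtain ⟨J, r, prem⟩ := E
    push_cast
    cases r with
    | lam => exact add_le_add_left (ih _ (.up 0 hE.sub id (by simp [rule])) (hE.other 0 id)) 1
    | app =>
      exact add_le_add_left (le_min (ih _ (.up 0 hE.sub id (by simp [rule])) (hE.other 0 id))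
        (ih _ (.up 1 hE.sub id (by simp [rule])) (hE.other 1 id))) 1
    | _ => exact absurd hg id
  | step hg _ ih =>
    rw [guardAt_iff hE.sub] at hg
    obtain ⟨J, r, prem⟩ := E
    cases r with
    | hyp v =>
      exact hE.le_marker fun w F ν hw hF => ih w ((accessStep_hyp_iff hE.sub rfl).2 hw) hF
    | nlvar => exact le_top
    | lam => exact absurd trivial hg
    | app => exact absurd trivial hg
    | vac =>
      exact ih (E := prem 0) (μ := μ) _ (.up 0 hE.sub id (by simp [rule])) (hE.other 0 id)
    | fixLetrec k c u =>
      exact ih (E := prem (Fin.last k)) (μ := updateMarkers μ u (depths u prem μ)) _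
        (.inPart hE.sub rfl) (hE.fix (Fin.last k))

lemma depth_eq_top_iff_forall_ok : D.depth ⊤ = ⊤ ↔ ∀ d, D.Ok d [] := by
  constructor
  · intro h d
    have h' := depth_le_okDepth D (D := D) (p := []) (by simp [ProofTree.sub])
    have ht : D.targetEnv [] = ⊤ := by
      funext v
      simp only [targetEnv]
      refine iInf₂_eq_top.2 fun w hw => ?_
      obtain ⟨q, i, hq, hne, -⟩ := hw
      exact absurd (List.prefix_nil.1 hq) hne
    rw [ht, h, top_le_iff] at h'
    exact le_okDepth.1 (h' ▸ le_top)
  · exact fun h => ENat.eq_top_iff_forall_ge.2 fun d => (h d).le_depth .root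

/-! ### Guardedness on access path cycles -/

variable (D) in
/-- A step of access paths that does not leave a guard. -/
def UnguardedStep (p q : List ℕ) : Prop := ¬ D.GuardAt p ∧ D.AccessStep p q

lemma Ok.acc {p : List ℕ} (h : D.Ok 1 p) : Acc (flip D.UnguardedStep) p := by
  obtain ⟨e, he⟩ : ∃ e, e = 1 := ⟨_, rfl⟩
  rw [← he] at h
  induction h with
  | zero => simp at he
  | guard hp => exact ⟨_, fun q hq => absurd hp hq.1⟩
  | step hp _ ih => exact ⟨_, fun q hq => ih q hq.2 he⟩

lemma not_rel_self_of_acc {α : Type*} {r : α → α → Prop} {a : α} (h : Acc r a) : ¬ r a a := by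
  induction h with
  | intro a _ ih => exact fun h => ih a h h

lemma ok_of_acc {p : List ℕ} (h : ∀ q, Relation.ReflTransGen D.AccessStep p q →
    Acc (flip D.UnguardedStep) q) (d : ℕ) : D.Ok d p := by
  induction d generalizing p with
  | zero => exact .zero p
  | succ d ihd =>
    induction h p .refl with
    | intro p _ ih =>
      by_cases hp : D.GuardAt p
      · exact .guard hp fun q hq => ihd fun q' hq' => h q' (.head hq hq')
      · exact .step hp fun q hq => ih q ⟨hp, hq⟩ fun q' hq' => h q' (.head hq hq')

lemma forall_ok_of_reachable {p q : List ℕ} (h : ∀ d, D.Ok d p)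
    (hq : Relation.ReflTransGen D.AccessStep p q) (d : ℕ) : D.Ok d q := by
  induction hq generalizing d with
  | refl => exact h d
  | tail _ hs ih =>
    cases ih (d + 1) with
    | guard _ h => exact h _ hs
    | step _ h => exact (h _ hs).pred

lemma finite_positions (D : ProofTree) : {p | (D.sub p).isSome}.Finite := by
  induction D with
  | node J r prem ih =>
    refine ((Set.finite_singleton []).union
      (Set.finite_iUnion fun j => (ih j).image (List.cons (j : ℕ)))).subset ?_
    rintro (_ | ⟨i, p⟩) hp
    · exact .inl rfl
    · simp only [Set.mem_ofPred_eq, sub] at hp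
      split_ifs at hp with hi
      · exact .inr (Set.mem_iUnion.2 ⟨⟨i, hi⟩, p, hp, rfl⟩)
      · simp at hp

lemma AccessStep.isSome {p q : List ℕ} (h : D.AccessStep p q) : (D.sub q).isSome := by
  cases h with
  | @up E i hE _ hi =>
    obtain ⟨J, r, prem⟩ := E
    exact sub_snoc hE ⟨i, hi⟩ ▸ rfl
  | @inPart E k c u hE hr =>
    obtain ⟨J, r, prem⟩ := E
    obtain rfl : r = Rule.fixLetrec k c u := hr
    exact sub_snoc hE (Fin.last k) ▸ rfl
  | unfRec _ _ _ hb _ =>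
    obtain ⟨J, k, c, u, prem, j, hs, -, rfl⟩ := hb
    exact sub_snoc hs j.castSucc ▸ rfl

lemma isSome_of_reachable {p : List ℕ} (h : Relation.ReflTransGen D.AccessStep [] p) :
    (D.sub p).isSome := by
  cases h with
  | refl => simp [sub]
  | tail _ h => exact h.isSome

/-- A cycle of unguarded steps as a segment of an access path. -/
lemma exists_unguarded_segment {p q : List ℕ} (h : Relation.TransGen D.UnguardedStep p q) :
    ∃ σ, (p :: σ ++ [q]).IsChain D.AccessStep ∧ ∀ a ∈ p :: σ, ¬ D.GuardAt a := by
  induction h using Relation.TransGen.head_induction_on with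
  | single h => exact ⟨[], by simpa using h.2, by simpa using h.1⟩
  | @head a b h _ ih =>
    obtain ⟨σ, h₁, h₂⟩ := ih
    refine ⟨b :: σ, ?_, ?_⟩
    · simpa using ⟨h.2, by simpa using h₁⟩
    · intro x hx
      rcases List.mem_cons.1 hx with rfl | hx
      · exact h.1
      · exact h₂ x hx

lemma exists_accessPath {p : List ℕ} (h : Relation.ReflTransGen D.AccessStep [] p) :
    ∃ π, D.IsAccessPath (π ++ [p]) := by
  induction h with
  | refl => exact ⟨[], rfl, by simp⟩
  | @tail b c _ h ih =>
    obtain ⟨π, h₁, h₂⟩ := ih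
    refine ⟨π ++ [b], ?_, ?_⟩
    · rw [List.head?_append, h₁]; rfl
    · rw [List.isChain_append]
      exact ⟨h₂, by simp, by simpa using h⟩

lemma transGen_of_isChain {R : List ℕ → List ℕ → Prop} {l : List (List ℕ)} {a b : List ℕ}
    (h : (a :: l ++ [b]).IsChain R) : Relation.TransGen (fun x y => x ∈ a :: l ∧ R x y) a b := by
  induction l generalizing a with
  | nil => exact .single ⟨by simp, by simpa using h⟩
  | cons c l ih =>
    simp only [List.cons_append, List.isChain_cons_cons] at h
    exact .head ⟨by simp, h.1⟩ (Relation.TransGen.mono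
      (fun x y hxy => ⟨List.mem_cons_of_mem _ hxy.1, hxy.2⟩) _ _ (ih (by simpa using h.2)))

/-- As there are finitely many formula occurrences, guardedness excludes infinite unguarded access
paths. -/
theorem guardedOnAccessPathCycles_iff : D.GuardedOnAccessPathCycles ↔ ∀ d, D.Ok d [] := by
  constructor
  · intro h
    refine ok_of_acc fun q hq => ?_
    let S := {p // Relation.ReflTransGen D.AccessStep [] p}
    have : Finite S := ((finite_positions D).subset fun p hp => isSome_of_reachable hp).to_subtype
    let R : S → S → Prop := fun a b => Relation.TransGen (flip D.UnguardedStep) a.1 b.1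
    have : IsTrans S R := ⟨fun a b c h h' => h.trans h'⟩
    have : Std.Irrefl R := ⟨fun a ha => by
      obtain ⟨σ, h₁, h₂⟩ := exists_unguarded_segment (Relation.transGen_swap.1 ha)
      obtain ⟨π, h₃, h₄⟩ := exists_accessPath a.2
      have hπ : D.IsAccessPath (π ++ a.1 :: σ ++ [a.1]) := by
        refine ⟨by rw [← h₃]; cases π <;> simp, ?_⟩
        rw [List.append_assoc, List.isChain_append]
        refine ⟨h₄.left_of_append, h₁, ?_⟩
        rw [List.isChain_append] at h₄
        simpa using h₄.2.2
      obtain ⟨b, hb, hg⟩ := h π a.1 σ hπ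
      exact h₂ b hb hg⟩
    have hwf : WellFounded R := Finite.wellFounded_of_trans_of_irrefl R
    suffices ∀ a : S, Acc (flip D.UnguardedStep) a.1 from this ⟨q, hq⟩
    intro a
    induction a using hwf.induction with
    | _ a ih => exact ⟨_, fun b hb => ih ⟨b, a.2.tail hb.2⟩ (.single hb)⟩
  · rintro h π p σ ⟨h₁, h₂⟩
    by_contra! hσ
    have hp : Relation.ReflTransGen D.AccessStep [] p := by
      rcases π with _ | ⟨a, π⟩
      · simp at h₁; rw [h₁]
      · obtain rfl : a = [] := by simpa using h₁
        have : (([] :: π) ++ [p]).IsChain D.AccessStep := by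
          have h₃ : [] :: π ++ p :: σ ++ [p] = ([] :: π ++ [p]) ++ (σ ++ [p]) := by simp
          rw [h₃] at h₂
          exact h₂.left_of_append
        exact (Relation.TransGen.mono (fun _ _ h => h.2) _ _
          (transGen_of_isChain this)).to_reflTransGen
    have hc : Relation.TransGen D.UnguardedStep p p := by
      rw [List.append_assoc] at h₂
      exact Relation.TransGen.mono (fun x y hxy => ⟨hσ x hxy.1, hxy.2⟩) _ _
        (transGen_of_isChain h₂.right_of_append)
    have hacc := (forall_ok_of_reachable h hp 1).acc.transGen
    exact not_rel_self_of_acc hacc (Relation.transGen_swap.2 hc)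

theorem bottommostGuarded_iff : D.BottommostGuarded ↔ D.depth ⊤ = ⊤ := by
  have key {D : ProofTree} : D.GuardedOnAccessPathCycles ↔ D.depth ⊤ = ⊤ :=
    guardedOnAccessPathCycles_iff.trans depth_eq_top_iff_forall_ok.symm
  constructor
  · intro h
    induction h with
    | fixLetrec _ h => exact key.1 h
    | @other J r prem hr _ ih =>
      cases r with
      | hyp | nlvar => rfl
      | lam | app | vac => simp [depth, ih]
      | fixLetrec => exact absurd trivial hr
  · intro h
    induction D with
    | node J r prem ih =>
      cases r with
      | hyp | nlvar => exact .other id nofun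
      | lam =>
        refine .other id fun j => ih j ?_
        rw [Subsingleton.elim j 0]
        simpa [depth] using h
      | app =>
        simp only [depth, ENat.add_eq_top, ENat.one_ne_top, or_false, min_eq_top] at h
        refine .other id fun j => ih j ?_
        match j with
        | 0 => exact h.1
        | 1 => exact h.2
      | vac => exact .other id fun j => ih j (Subsingleton.elim j 0 ▸ h)
      | fixLetrec => exact .fixLetrec trivial (key.2 h)

end ProofTree

/-! ### Derivations without the side-condition on cycles -/

namespace Tm

/-- The number of symbols of a term. -/
def size : Tm → ℕ
  | var _ => 1
  | const _ => 1
  | lam L => size L + 1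
  | app L₀ L₁ => size L₀ + size L₁ + 1
  | letrec _ B L => (∑ j, size (B j)) + size L + 1

lemma size_instConstsAux {k : ℕ} (c : Fin k → ℕ) (L : Tm) (d : ℕ) :
    (instConstsAux c d L).size = L.size := by
  induction L generalizing d with
  | var i =>
    simp only [instConstsAux]
    split_ifs <;> rfl
  | const c => rfl
  | lam L ih => simp only [instConstsAux, size, ih]
  | app L₀ L₁ ih₀ ih₁ => simp only [instConstsAux, size, ih₀, ih₁]
  | letrec m B L ihB ih => simp only [instConstsAux, size, ihB, ih]

lemma freeIn_of_instConstsAux {k : ℕ} {c : Fin k → ℕ} {L : Tm} {d i : ℕ}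
    (h : FreeIn (i + d) (instConstsAux c d L)) : FreeIn (i + k + d) L := by
  induction L generalizing d with
  | var j =>
    simp only [instConstsAux] at h
    split_ifs at h <;> simp only [FreeIn] at h ⊢ <;> omega
  | const c => exact h
  | lam L ih => exact ih (d := d + 1) h
  | app L₀ L₁ ih₀ ih₁ => exact h.imp ih₀ ih₁
  | letrec m B L ihB ih =>
    rcases h with ⟨j, h⟩ | h
    · rw [add_assoc] at h
      exact .inl ⟨j, by rw [add_assoc]; exact ihB j h⟩
    · rw [add_assoc] at h
      exact .inr (by rw [add_assoc]; exact ih h)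

lemma hasConst_of_instConstsAux {k : ℕ} {c : Fin k → ℕ} {L : Tm} {d a : ℕ}
    (h : HasConst a (instConstsAux c d L)) : HasConst a L ∨ ∃ i, c i = a := by
  induction L generalizing d with
  | var j =>
    simp only [instConstsAux] at h
    split_ifs at h
    · exact absurd h id
    · exact .inr ⟨_, Eq.symm h⟩
    · exact absurd h id
  | const c => exact .inl h
  | lam L ih => exact ih h
  | app L₀ L₁ ih₀ ih₁ =>
    rcases h with h | h
    · exact (ih₀ h).imp_left .inl
    · exact (ih₁ h).imp_left .inr
  | letrec m B L ihB ih =>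
    rcases h with ⟨j, h⟩ | h
    · exact (ihB j h).imp_left fun h => .inl ⟨j, h⟩
    · exact (ih h).imp_left .inr

lemma exists_const_bound (L : Tm) : ∃ b, ∀ c, L.HasConst c → c < b := by
  induction L with
  | var i => exact ⟨0, fun _ => False.elim⟩
  | const c => exact ⟨c + 1, fun a ha => Nat.lt_succ_of_le (Eq.le ha)⟩
  | lam L ih => exact ih
  | app L₀ L₁ ih₀ ih₁ =>
    obtain ⟨b₀, h₀⟩ := ih₀
    obtain ⟨b₁, h₁⟩ := ih₁
    exact ⟨max b₀ b₁, fun c hc => lt_max_iff.2 (hc.imp (h₀ c) (h₁ c))⟩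
  | letrec m B L ihB ih =>
    choose b hb using ihB
    obtain ⟨b', hb'⟩ := ih
    refine ⟨max (Finset.univ.sup b) b', fun c hc => lt_max_iff.2 (hc.imp ?_ (hb' c))⟩
    rintro ⟨j, hj⟩
    exact (hb j c hj).trans_le (Finset.le_sup (Finset.mem_univ j))

lemma IsTerm.lt_of_freeIn {n i : ℕ} {L : Tm} (h : L.IsTerm n) (hi : L.FreeIn i) : i < n := by
  induction L generalizing n i with
  | var j => exact hi ▸ h
  | const c => exact absurd h id
  | lam L ih => exact Nat.lt_of_succ_lt_succ (ih h hi)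
  | app L₀ L₁ ih₀ ih₁ => exact hi.elim (ih₀ h.1) (ih₁ h.2)
  | letrec k B L ihB ih =>
    rcases hi with ⟨j, hi⟩ | hi
    · exact Nat.lt_of_add_lt_add_right (ihB j (h.1 j) hi)
    · exact Nat.lt_of_add_lt_add_right (ih h.2 hi)

lemma IsTerm.not_hasConst {n c : ℕ} {L : Tm} (h : L.IsTerm n) : ¬ L.HasConst c := by
  induction L generalizing n with
  | var j => exact id
  | const c => exact absurd h id
  | lam L ih => exact ih h
  | app L₀ L₁ ih₀ ih₁ => exact not_or.2 ⟨ih₀ h.1, ih₁ h.2⟩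
  | letrec k B L ihB ih => exact not_or.2 ⟨fun ⟨j, hj⟩ => ihB j (h.1 j) hj, ih h.2⟩

end Tm

namespace ProofTree

/-- `Suitable m J D`: `D` is a derivation of `J`, possibly not guarded on access path cycles, in
which a constant `c` is assumed, with itself as marker, only under a prefix of length `m c`, and
only if it occurs in `J`; and threads from such an assumption downwards stay above that length. -/
structure Suitable (m : ℕ → ℕ) (J : Judgement) (D : ProofTree) : Prop where
  isUgDerivation : D.IsUgDerivation
  concl_eq : D.concl = J
  openAssumption : ∀ v K, D.OpenAssumption v K → J.tm.HasConst v ∧ K = ⟨m v, Tm.const v⟩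
  onThread : ∀ v K, D.OnThread v K → m v ≤ K.len

variable {m : ℕ → ℕ}

lemma exists_openAssumption_of_onThread {D : ProofTree} {v : ℕ} {K : Judgement}
    (h : D.OnThread v K) : ∃ K', D.OpenAssumption v K' := by
  induction h with
  | concl h => exact ⟨_, h⟩
  | step j hr _ ih => exact ⟨_, .step j hr ih.choose_spec⟩

/-- The prefix of the premise is weakened by one variable. -/
lemma Suitable.vac {n : ℕ} {L : Tm} {D : ProofTree} (h : Suitable m ⟨n, L⟩ D)
    (hL : ∀ c, L.HasConst c → (L.shift 1).HasConst c) (hm : ∀ c, L.HasConst c → m c ≤ n) :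
    Suitable m ⟨n + 1, L.shift 1⟩ (node ⟨n + 1, L.shift 1⟩ Rule.vac fun _ => D) where
  isUgDerivation := .vac n L _ h.concl_eq h.isUgDerivation
  concl_eq := rfl
  openAssumption v K hK := by
    cases hK with
    | step j _ hK => exact ⟨hL v (h.openAssumption v K hK).1, (h.openAssumption v K hK).2⟩
  onThread v K hK := by
    cases hK with
    | concl hK =>
      cases hK with
      | step j _ hK => exact (hm v (h.openAssumption v _ hK).1).trans (Nat.le_succ n)
    | step j _ hK => exact h.onThread v K hK

lemma exists_suitable_var {n i : ℕ} (h : i < n) : ∃ D, Suitable m ⟨n, Tm.var i⟩ D := by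
  induction n generalizing i with
  | zero => omega
  | succ n ih =>
    rcases i with _ | i
    · refine ⟨node ⟨n + 1, Tm.var 0⟩ Rule.nlvar Fin.elim0, .nlvar n _, rfl, fun v K hK => ?_,
        fun v K hK => ?_⟩
      · cases hK with
        | step j => exact j.elim0
      · obtain ⟨_, hK⟩ := exists_openAssumption_of_onThread hK
        cases hK with
        | step j => exact j.elim0
    · obtain ⟨D, hD⟩ := ih (Nat.lt_of_succ_lt_succ h)
      exact ⟨_, hD.vac (fun _ => id) fun _ => False.elim⟩

lemma exists_suitable_const {n c : ℕ} (h : m c ≤ n) : ∃ D, Suitable m ⟨n, Tm.const c⟩ D := by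
  induction n, h using Nat.le_induction with
  | base =>
    refine ⟨node ⟨m c, Tm.const c⟩ (Rule.hyp c) Fin.elim0, .hyp _ _ _ _, rfl, fun v K hK => ?_,
      fun v K hK => ?_⟩
    · cases hK with
      | hyp => exact ⟨rfl, rfl⟩
      | step j => exact j.elim0
    · cases hK with
      | concl hK =>
        cases hK with
        | hyp => exact le_rfl
        | step j => exact j.elim0
      | step j => exact j.elim0
  | succ n hn ih =>
    obtain ⟨D, hD⟩ := ih
    exact ⟨_, hD.vac (fun _ => id) fun a (ha : a = c) => ha ▸ hn⟩

/-- Every term over the prefix has a derivation without the side-condition on cycles: prefix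
variables are dropped only directly below axioms and marked assumptions. -/
lemma exists_suitable (L : Tm) (m : ℕ → ℕ) (n : ℕ) (hv : ∀ i, L.FreeIn i → i < n)
    (hm : ∀ c, L.HasConst c → m c ≤ n) : ∃ D, Suitable m ⟨n, L⟩ D := by
  match L with
  | .var i => exact exists_suitable_var (hv i rfl)
  | .const c => exact exists_suitable_const (hm c rfl)
  | .lam L =>
    obtain ⟨D, hD⟩ := exists_suitable L m (n + 1)
      (fun i hi => by
        rcases i with _ | i
        · omega
        · exact Nat.succ_lt_succ (hv i hi))
      (fun c hc => (hm c hc).trans (Nat.le_succ n))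
    refine ⟨node ⟨n, .lam L⟩ Rule.lam fun _ => D, .lam n L _ hD.concl_eq hD.isUgDerivation, rfl,
      fun v K hK => ?_, fun v K hK => ?_⟩
    · cases hK with
      | step j _ hK => exact hD.openAssumption v K hK
    · cases hK with
      | concl hK =>
        cases hK with
        | step j _ hK => exact hm v (hD.openAssumption v _ hK).1
      | step j _ hK => exact hD.onThread v K hK
  | .app L₀ L₁ =>
    obtain ⟨D₀, h₀⟩ := exists_suitable L₀ m n (fun i hi => hv i (.inl hi))
      fun c hc => hm c (.inl hc)
    obtain ⟨D₁, h₁⟩ := exists_suitable L₁ m n (fun i hi => hv i (.inr hi))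
      fun c hc => hm c (.inr hc)
    let prem : Fin Rule.app.arity → ProofTree := ![D₀, D₁]
    have ho (v K j) (hK : (prem j).OpenAssumption v K) :
        (Tm.app L₀ L₁).HasConst v ∧ K = ⟨m v, Tm.const v⟩ := by
      match j with
      | 0 => exact (h₀.openAssumption v K hK).imp_left .inl
      | 1 => exact (h₁.openAssumption v K hK).imp_left .inr
    refine ⟨node ⟨n, .app L₀ L₁⟩ Rule.app prem,
      .app n L₀ L₁ _ h₀.concl_eq h₁.concl_eq h₀.isUgDerivation h₁.isUgDerivation, rfl,
      fun v K hK => ?_, fun v K hK => ?_⟩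
    · cases hK with
      | step j _ hK => exact ho v K j hK
    · cases hK with
      | concl hK =>
        cases hK with
        | step j _ hK => exact hm v (ho v _ j hK).1
      | step j _ hK =>
        match j with
        | 0 => exact h₀.onThread v K hK
        | 1 => exact h₁.onThread v K hK
  | .letrec k B L =>
    obtain ⟨b, hb⟩ := (Tm.letrec k B L).exists_const_bound
    let c : Fin k → ℕ := fun i => b + i
    have hc : Function.Injective c := fun i j h => Fin.ext (Nat.add_left_cancel h)
    have hfresh (i : Fin k) : ¬ (Tm.letrec k B L).HasConst (c i) := fun h =>
      absurd (hb _ h) (Nat.not_lt.2 (Nat.le_add_right b i))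
    -- the new constants are assumed under the prefix of the conclusion
    let m' : ℕ → ℕ := fun a => open scoped Classical in if ∃ i, c i = a then n else m a
    have hm'c (i) : m' (c i) = n := if_pos ⟨i, rfl⟩
    have hm' {a} (ha : ¬ ∃ i, c i = a) : m' a = m a := if_neg ha
    have inst (P : Tm) (hPv : ∀ i, P.FreeIn (i + k) → i < n)
        (hPc : ∀ a, P.HasConst a → (Tm.letrec k B L).HasConst a) :
        (∀ i, (P.instConsts c).FreeIn i → i < n) ∧
          (∀ a, (P.instConsts c).HasConst a → m' a ≤ n) := by
      refine ⟨fun i hi => hPv i (Tm.freeIn_of_instConstsAux (d := 0) hi), fun a ha => ?_⟩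
      by_cases hac : ∃ i, c i = a
      · exact (if_pos hac).le
      · rw [hm' hac]
        exact hm a (hPc a ((Tm.hasConst_of_instConstsAux ha).resolve_right hac))
    have hsB (i : Fin k) : (B i).size < (Tm.letrec k B L).size := by
      have := Finset.single_le_sum (f := fun j => (B j).size) (fun _ _ => Nat.zero_le _)
        (Finset.mem_univ i)
      simp only [Tm.size] at this ⊢
      omega
    have hiB (i : Fin k) := inst (B i) (fun i' h => hv i' (.inl ⟨i, h⟩)) fun a h => .inl ⟨i, h⟩
    have hiL := inst L (fun i' h => hv i' (.inr h)) fun a h => .inr h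
    have hDB (i : Fin k) := exists_suitable ((B i).instConsts c) m' n (hiB i).1 (hiB i).2
    obtain ⟨DL, hDL⟩ := exists_suitable (L.instConsts c) m' n hiL.1 hiL.2
    choose DB hDB using hDB
    let prem : Fin (k + 1) → ProofTree := Fin.snoc (α := fun _ => ProofTree) DB DL
    have hpB (i : Fin k) : prem i.castSucc = DB i := by simp [prem]
    have hpL : prem (Fin.last k) = DL := by simp [prem]
    have hprem (j) : ∃ P : Tm, Suitable m' ⟨n, P.instConsts c⟩ (prem j) ∧
        ∀ a, P.HasConst a → (Tm.letrec k B L).HasConst a := by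
      induction j using Fin.lastCases with
      | last => exact ⟨L, hpL ▸ hDL, fun a h => .inr h⟩
      | cast i => exact ⟨B i, hpB i ▸ hDB i, fun a h => .inl ⟨i, h⟩⟩
    have ho (v K j) (hK : (prem j).OpenAssumption v K) :
        K = ⟨m' v, Tm.const v⟩ ∧ ((Tm.letrec k B L).HasConst v ∨ ∃ i, c i = v) := by
      obtain ⟨P, hP, hPc⟩ := hprem j
      obtain ⟨h₁, h₂⟩ := hP.openAssumption v K hK
      exact ⟨h₂, (Tm.hasConst_of_instConstsAux h₁).imp_left (hPc v)⟩
    refine ⟨node ⟨n, .letrec k B L⟩ (Rule.fixLetrec k c c) prem,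
      .fixLetrec n k B L c c prem hc hc (fun i j h => hfresh i (.inl ⟨j, h⟩))
        (fun i h => hfresh i (.inr h)) (fun i => hpB i ▸ (hDB i).concl_eq)
        (hpL ▸ hDL.concl_eq) (fun j i K hK => hm'c i ▸ (ho _ K j hK).1) (fun j i v a hK => ?_)
        (fun j i K hK => ?_) (fun j => ?_), rfl,
      fun v K hK => ?_, fun v K hK => ?_⟩
    · have := (ho _ _ j hK).1
      simp only [Judgement.mk.injEq, Tm.const.injEq] at this
      exact this.2.symm
    · obtain ⟨P, hP, -⟩ := hprem j
      exact hm'c i ▸ hP.onThread _ K hK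
    · obtain ⟨P, hP, -⟩ := hprem j
      exact hP.isUgDerivation
    · cases hK with
      | step j hr hK =>
        obtain ⟨h₁, h₂⟩ := ho v K j hK
        exact ⟨h₂.resolve_right hr, hm' hr ▸ h₁⟩
    · cases hK with
      | concl hK =>
        cases hK with
        | step j hr hK => exact hm v ((ho v _ j hK).2.resolve_right hr)
      | step j hr hK =>
        obtain ⟨P, hP, -⟩ := hprem j
        exact hm' hr ▸ hP.onThread v K hK
termination_by L.size
decreasing_by
  · simp [Tm.size]
  · simp [Tm.size]
  · simp [Tm.size]
  · rw [Tm.instConsts, Tm.size_instConstsAux]; exact hsB i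
  · rw [Tm.instConsts, Tm.size_instConstsAux]; simp [Tm.size]

end ProofTree

theorem derivable_iff {L : Tm} (hL : L.IsTerm 0) : Derivable ⟨0, L⟩ ↔ L.depth ⊤ ⊤ = ⊤ := by
  have key {D : ProofTree} (h : D.IsUgDerivation) : D.depth ⊤ = D.concl.tm.depth ⊤ ⊤ :=
    h.depth_eq fun _ _ _ _ => rfl
  constructor
  · rintro ⟨D, ⟨h₁, h₂⟩, -, h₃⟩
    rw [ProofTree.bottommostGuarded_iff, key h₁, h₃] at h₂
    exact h₂
  · intro h
    obtain ⟨D, hD⟩ := ProofTree.exists_suitable L 0 0 (fun i hi => hL.lt_of_freeIn hi)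
      fun c hc => absurd hc hL.not_hasConst
    refine ⟨D, ⟨hD.isUgDerivation, ?_⟩, fun v K hK => ?_, hD.concl_eq⟩
    · rw [ProofTree.bottommostGuarded_iff, key hD.isUgDerivation, hD.concl_eq]
      exact h
    · exact hL.not_hasConst (hD.openAssumption v K hK).1

/-! ### Terms of non-zero productive depth have a head normal form -/

namespace Tm

lemma liftRen_comp (k : ℕ) (ρ' ρ : ℕ → ℕ) : liftRen k ρ' ∘ liftRen k ρ = liftRen k (ρ' ∘ ρ) := by
  funext i
  induction i using binder_cases k <;> simp [liftRen_fin, liftRen_add]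

lemma rename_rename (L : Tm) (ρ' ρ : ℕ → ℕ) :
    rename ρ' (rename ρ L) = rename (ρ' ∘ ρ) L := by
  induction L generalizing ρ ρ' with
  | var i => rfl
  | const c => rfl
  | lam L ih => simp only [rename, ih, liftRen_comp]
  | app L₀ L₁ ih₀ ih₁ => simp only [rename, ih₀, ih₁]
  | letrec k B L ihB ih => simp only [rename, ihB, ih, liftRen_comp]

lemma liftRen_id (k : ℕ) : liftRen k id = id := by
  funext i
  induction i using binder_cases k <;> simp [liftRen_fin, liftRen_add]

lemma rename_id (L : Tm) : rename id L = L := by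
  induction L with
  | var i => rfl
  | const c => rfl
  | lam L ih => simp only [rename, liftRen_id, ih]
  | app L₀ L₁ ih₀ ih₁ => simp only [rename, ih₀, ih₁]
  | letrec k B L ihB ih => simp only [rename, liftRen_id, ihB, ih]

/-- Variables, abstractions and applications. -/
inductive IsHead : Tm → Prop
  | var (i : ℕ) : IsHead (var i)
  | lam (L : Tm) : IsHead (lam L)
  | app (L₀ L₁ : Tm) : IsHead (app L₀ L₁)

/-- The term has a reduct that starts with a symbol of infinite terms, by steps at the root. -/
def HeadReach (L : Tm) : Prop := ∃ L', Relation.ReflTransGen UnfRule L L' ∧ IsHead L'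

lemma HeadReach.of_rule {L L' : Tm} (h : UnfRule L L') (h' : HeadReach L') : HeadReach L :=
  let ⟨P, hP, hh⟩ := h'
  ⟨P, .head h hP, hh⟩

lemma headReach_letrec_free (k : ℕ) (B : Fin k → Tm) (i : ℕ) :
    HeadReach (letrec k B (var (i + k))) := by
  have h0 (B : Fin 0 → Tm) (i : ℕ) : HeadReach (letrec 0 B (var i)) :=
    .of_rule (.nil B _) ⟨_, .refl, .var _⟩
  rcases Nat.eq_zero_or_pos k with rfl | hk
  · exact h0 B _
  · refine .of_rule (.reduce k 0 Fin.elim0 B Fin.elim0 _ (var i) hk (fun i => i.elim0) ?_ ?_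
      fun j => j.elim0) (h0 _ i)
    · intro j
      simp only [Set.mem_range, IsEmpty.exists_iff, false_iff]
      intro h
      induction h with
      | base j hj =>
        simp only [FreeIn] at hj
        omega
      | step _ _ _ _ ih => exact ih
    · simp [rename, embedRen]

/-- The binding group `B'` contains a copy of the binding group `B`, and `τ` is the corresponding
renaming, which maps free variables to free variables. -/
structure Extends (τ : ℕ → ℕ) {k k' : ℕ} (B : Fin k → Tm) (B' : Fin k' → Tm) : Prop where
  bound : ∀ j : Fin k, ∃ j' : Fin k', τ j = j' ∧ B' j' = rename τ (B j)
  free : ∀ i, ∃ i', τ (i + k) = i' + k'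

lemma Extends.refl {k : ℕ} (B : Fin k → Tm) : Extends id B B :=
  ⟨fun j => ⟨j, rfl, (rename_id _).symm⟩, fun i => ⟨i, rfl⟩⟩

lemma Extends.comp {τ τ' : ℕ → ℕ} {k k' k'' : ℕ} {B : Fin k → Tm} {B' : Fin k' → Tm}
    {B'' : Fin k'' → Tm} (h' : Extends τ' B' B'') (h : Extends τ B B') :
    Extends (τ' ∘ τ) B B'' := by
  constructor
  · intro j
    obtain ⟨j', h₁, h₂⟩ := h.bound j
    obtain ⟨j'', h₃, h₄⟩ := h'.bound j'
    exact ⟨j'', by simp [h₁, h₃], by rw [h₄, h₂, rename_rename]⟩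
  · intro i
    obtain ⟨i', h₁⟩ := h.free i
    obtain ⟨i'', h₂⟩ := h'.free i'
    exact ⟨i'', by simp [h₁, h₂]⟩

lemma extends_append {k m : ℕ} (B : Fin k → Tm) (C : Fin m → Tm) :
    Extends (· + m) B (Fin.addCases C (fun j => shift m (B j)) : Fin (m + k) → Tm) :=
  ⟨fun j => ⟨Fin.natAdd m j, by simp [add_comm], by simp [shift]⟩,
    fun i => ⟨i, by rw [add_assoc, add_comm k m]⟩⟩

/-- The variable `i` has a head normal form under the binding group `B`, even if `B` is extended. -/
def VarReach {k : ℕ} (B : Fin k → Tm) (i : ℕ) : Prop :=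
  ∀ (k' : ℕ) (B' : Fin k' → Tm) (τ : ℕ → ℕ), Extends τ B B' → HeadReach (letrec k' B' (var (τ i)))

lemma VarReach.extend {k k' : ℕ} {B : Fin k → Tm} {B' : Fin k' → Tm} {τ : ℕ → ℕ} {i : ℕ}
    (h : VarReach B i) (hτ : Extends τ B B') : VarReach B' (τ i) :=
  fun _ _ _ h' => h _ _ _ (h'.comp hτ)

/-- The logical relation for adequacy: if a term has non-zero productive depth in an environment
whose non-zero values are justified by `B`, then it has a head normal form under `B`. Constants are
given the value `0`, as they are not symbols of infinite terms. -/
def Adequate (L : Tm) : Prop :=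
  ∀ (σ : ℕ → ℕ∞) (ρ : ℕ → ℕ) (k : ℕ) (B : Fin k → Tm), depth 0 L σ ≠ 0 →
    (∀ i, σ i ≠ 0 → VarReach B (ρ i)) → HeadReach (letrec k B (rename ρ L))

/-- The values `⊤` of those recursion variables that have a head normal form, and `0` of the others,
solve the equations up to inequality. -/
lemma headReach_of_depth_letrec_ne_zero {m : ℕ} {C : Fin m → Tm} {L : Tm}
    (hC : ∀ j, Adequate (C j)) (hL : Adequate L) {σ : ℕ → ℕ∞} {ρ : ℕ → ℕ} {k : ℕ}
    {B : Fin k → Tm} (hB : ∀ i : Fin m, ∃ j : Fin k, ρ i = j ∧ B j = rename ρ (C i))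
    (hσ : ∀ i, σ i ≠ 0 → VarReach B (ρ (i + m))) (h : depth 0 (letrec m C L) σ ≠ 0) :
    HeadReach (letrec k B (rename ρ L)) := by
  classical
  let X : Fin m → ℕ∞ := fun i => if VarReach B (ρ i) then ⊤ else 0
  have hX (i : ℕ) (hi : extendEnv X σ i ≠ 0) : VarReach B (ρ i) := by
    induction i using binder_cases m with
    | bound i => simpa [X] using hi
    | outer i => exact hσ i (by simpa using hi)
  have hle : depths 0 C σ ≤ X := depths_le fun i => by
    by_cases hi : VarReach B (ρ i)
    · simp [X, hi]
    · refine le_of_eq_of_le (by_contra fun hne => hi ?_) (zero_le)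
      intro k' B' τ hτ
      obtain ⟨j, h₁, h₂⟩ := hB i
      obtain ⟨j', h₃, h₄⟩ := hτ.bound j
      rw [h₁, h₃]
      refine .of_rule (.unfRec k' B' j') ?_
      rw [h₄, h₂, rename_rename]
      exact hC i _ _ _ _ hne fun i hi => (hX i hi).extend hτ
  refine hL (extendEnv X σ) ρ k B (fun h0 => h ?_) hX
  rw [depth_letrec]
  exact le_antisymm (h0 ▸ depth_mono L (extendEnv_mono hle le_rfl)) zero_le

lemma adequate (L : Tm) : Adequate L := by
  induction L with
  | var i =>
    intro σ ρ k B h hσ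
    exact hσ i h _ _ _ (Extends.refl B)
  | const c => exact fun σ ρ k B h => absurd rfl h
  | lam L => exact fun _ _ k B _ _ => ⟨_, .single (.lam k B _), .lam _⟩
  | app L₀ L₁ => exact fun _ _ k B _ _ => ⟨_, .single (.app k B _ _), .app _ _⟩
  | letrec m C L hC hL =>
    intro σ ρ k B h hσ
    refine .of_rule (.letrec k m B _ _) (headReach_of_depth_letrec_ne_zero hC hL (fun i => ?_)
      (fun i hi => ?_) h)
    · exact ⟨Fin.castAdd k i, by simp [liftRen_fin], by simp⟩
    · rw [liftRen_add]
      exact (hσ i hi).extend (extends_append B _)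

lemma headReach_of_depth_ne_zero {L : Tm} (h : depth 0 L ⊤ ≠ 0) : HeadReach L := by
  cases L with
  | var i => exact ⟨_, .refl, .var i⟩
  | const c => exact absurd rfl h
  | lam L => exact ⟨_, .refl, .lam L⟩
  | app L₀ L₁ => exact ⟨_, .refl, .app L₀ L₁⟩
  | letrec k B L =>
    rw [← rename_id L]
    refine headReach_of_depth_letrec_ne_zero (C := B) (fun j => adequate (B j)) (adequate L)
      (fun i => ⟨i, rfl, (rename_id _).symm⟩) (fun i _ k' B' τ hτ => ?_) h
    obtain ⟨i', hi'⟩ := hτ.free i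
    rw [id, hi']
    exact headReach_letrec_free _ _ _

/-! ### Unfolding preserves the abstraction prefix -/

lemma IsTerm.rename {n n' : ℕ} {L : Tm} {ρ : ℕ → ℕ} (h : L.IsTerm n) (hρ : ∀ i < n, ρ i < n') :
    (L.rename ρ).IsTerm n' := by
  have lift {n n' : ℕ} {ρ : ℕ → ℕ} (hρ : ∀ i < n, ρ i < n') (k : ℕ) :
      ∀ i < n + k, liftRen k ρ i < n' + k := by
    intro i
    induction i using binder_cases k with
    | bound i => intro _; rw [liftRen_fin]; omega
    | outer i => intro hi; rw [liftRen_add]; have := hρ i (by omega); omega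
  induction L generalizing n n' ρ with
  | var i => exact hρ i h
  | const c => exact h
  | lam L ih => exact ih h (lift hρ 1)
  | app L₀ L₁ ih₀ ih₁ => exact ⟨ih₀ h.1 hρ, ih₁ h.2 hρ⟩
  | letrec k B L ihB ih => exact ⟨fun j => ihB j (h.1 j) (lift hρ k), ih h.2 (lift hρ k)⟩

lemma IsTerm.of_rename {n n' : ℕ} {L : Tm} {ρ : ℕ → ℕ} (h : (L.rename ρ).IsTerm n')
    (hρ : ∀ i, ρ i < n' → i < n) : L.IsTerm n := by
  have lift {n n' : ℕ} {ρ : ℕ → ℕ} (hρ : ∀ i, ρ i < n' → i < n) (k : ℕ) :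
      ∀ i, liftRen k ρ i < n' + k → i < n + k := by
    intro i
    induction i using binder_cases k with
    | bound i => intro _; omega
    | outer i => intro hi; rw [liftRen_add] at hi; have := hρ i (by omega); omega
  induction L generalizing n n' ρ with
  | var i => exact hρ i h
  | const c => exact h
  | lam L ih => exact ih h (lift hρ 1)
  | app L₀ L₁ ih₀ ih₁ => exact ⟨ih₀ h.1 hρ, ih₁ h.2 hρ⟩
  | letrec k B L ihB ih => exact ⟨fun j => ihB j (h.1 j) (lift hρ k), ih h.2 (lift hρ k)⟩

lemma UnfRule.isTerm {L L' : Tm} (h : UnfRule L L') {n : ℕ} (hL : L.IsTerm n) : L'.IsTerm n := by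
  cases h with
  | app k B L₀ L₁ => exact ⟨⟨hL.1, hL.2.1⟩, ⟨hL.1, hL.2.2⟩⟩
  | lam k B L =>
    refine ⟨fun j => (hL.1 j).rename fun i => ?_, IsTerm.rename (L := L) hL.2 fun i hi => ?_⟩
    · induction i using binder_cases k with
      | bound i => intro _; rw [liftRen_fin]; omega
      | outer i => intro hi; rw [liftRen_add]; omega
    · simp only [exchangeRen]
      split_ifs <;> omega
  | letrec k m B C L =>
    obtain ⟨hB, hC, hL⟩ := hL
    rw [add_assoc, add_comm k m] at hL
    refine ⟨fun j => ?_, hL⟩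
    refine Fin.addCases (fun j => ?_) (fun j => ?_) j
    · simpa [add_assoc, add_comm k m] using hC j
    · simpa [shift] using (hB j).rename fun i hi => by omega
  | unfRec k B i => exact ⟨hL.1, hL.1 i⟩
  | nil B L => exact hL.2
  | reduce k k' e B B' L L' _ _ _ h hB =>
    have he (i : ℕ) : embedRen e i < n + k → i < n + k' := by
      intro hi
      simp only [embedRen] at hi
      split_ifs at hi <;> omega
    exact ⟨fun j => (hB j ▸ hL.1 (e j)).of_rename he, (h ▸ hL.2).of_rename he⟩

end Tm

/-! ### Infinite terms -/

namespace InfTm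

lemma lam_injective {M N : InfTm} (h : lam M = lam N) : M = N := by
  injection PFunctor.M.mk_inj h with _ h
  exact congrFun h (0 : Fin 1)

lemma app_injective {M M' N N' : InfTm} (h : app M N = app M' N') : M = M' ∧ N = N' := by
  injection PFunctor.M.mk_inj h with _ h
  exact ⟨congrFun h (0 : Fin 2), congrFun h (1 : Fin 2)⟩

lemma var_injective {i j : ℕ} (h : var i = var j) : i = j := by
  injection PFunctor.M.mk_inj h with h
  injection h

/-- The symbol at the root. -/
def sym (M : InfTm) : InfSym := (PFunctor.M.dest (F := infSig) M).1

@[simp] lemma sym_var (i : ℕ) : (var i).sym = .var i := rfl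
@[simp] lemma sym_lam (M : InfTm) : (lam M).sym = .lam := rfl
@[simp] lemma sym_app (M N : InfTm) : (app M N).sym = .app := rfl

end InfTm

/-- The terms of infinite productive depth. -/
abbrev Productive : Type := {L : Tm // L.depth 0 ⊤ = ⊤}

/-- `HeadStep f L N`: the term `L` has a reduct by steps at the root that starts with the same
symbol as `N`, and `f` assigns the arguments of `N` to those of the reduct. -/
inductive HeadStep (f : Productive → InfTm) (L : Tm) : InfTm → Prop
  | var (i : ℕ) : Relation.ReflTransGen Tm.UnfRule L (.var i) → HeadStep f L (.var i)
  | lam (P : Productive) : Relation.ReflTransGen Tm.UnfRule L (.lam P) → HeadStep f L (.lam (f P))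
  | app (P Q : Productive) : Relation.ReflTransGen Tm.UnfRule L (.app P Q) →
      HeadStep f L (.app (f P) (f Q))

namespace Tm

lemma depth_eq_of_reflTransGen {L L' : Tm} (h : Relation.ReflTransGen UnfRule L L')
    {κ σ : ℕ → ℕ∞} : depth κ L σ = depth κ L' σ := by
  induction h with
  | refl => rfl
  | tail _ h ih => rw [ih, h.depth_eq]

end Tm

/-- The infinite term to which a productive term unfolds is obtained by corecursion. -/
lemma exists_headStep : ∃ f : Productive → InfTm, ∀ P : Productive, HeadStep f P (f P) := by
  have layer (P : Productive) : ∃ y : infSig Productive, ∀ f : Productive → InfTm,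
      HeadStep f P (PFunctor.M.mk (F := infSig) (infSig.map f y)) := by
    obtain ⟨L, hL, hh⟩ := Tm.headReach_of_depth_ne_zero (L := P) (by rw [P.2]; simp)
    have hd : L.depth 0 ⊤ = ⊤ := by rw [← Tm.depth_eq_of_reflTransGen hL, P.2]
    cases hh with
    | var i =>
      refine ⟨⟨.var i, Fin.elim0⟩, fun f => ?_⟩
      have he : infSig.map f ⟨.var i, Fin.elim0⟩ = ⟨.var i, Fin.elim0⟩ :=
        congrArg (Sigma.mk _) (funext fun j => Fin.elim0 j)
      exact Eq.subst (motive := HeadStep f P) (congrArg (PFunctor.M.mk (F := infSig)) he.symm)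
        (.var i hL)
    | lam L =>
      have h : L.depth 0 ⊤ = ⊤ := by simpa [Tm.depth, extendEnv_const_top] using hd
      refine ⟨⟨.lam, ![⟨L, h⟩]⟩, fun f => ?_⟩
      have he : infSig.map f ⟨.lam, ![⟨L, h⟩]⟩ = ⟨.lam, ![f ⟨L, h⟩]⟩ :=
        congrArg (Sigma.mk _) (funext fun j => match j with | (0 : Fin 1) => rfl)
      exact Eq.subst (motive := HeadStep f P) (congrArg (PFunctor.M.mk (F := infSig)) he.symm)
        (.lam ⟨L, h⟩ hL)
    | app L₀ L₁ =>
      have h : L₀.depth 0 ⊤ = ⊤ ∧ L₁.depth 0 ⊤ = ⊤ := by simpa [Tm.depth, min_eq_top] using hd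
      refine ⟨⟨.app, ![⟨L₀, h.1⟩, ⟨L₁, h.2⟩]⟩, fun f => ?_⟩
      have he : infSig.map f ⟨.app, ![⟨L₀, h.1⟩, ⟨L₁, h.2⟩]⟩ =
          ⟨.app, ![f ⟨L₀, h.1⟩, f ⟨L₁, h.2⟩]⟩ :=
        congrArg (Sigma.mk _) (funext fun j => match j with
          | (0 : Fin 2) => rfl
          | (1 : Fin 2) => rfl)
      exact Eq.subst (motive := HeadStep f P) (congrArg (PFunctor.M.mk (F := infSig)) he.symm)
        (.app ⟨L₀, h.1⟩ ⟨L₁, h.2⟩ hL)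
  choose y hy using layer
  refine ⟨PFunctor.M.corec y, fun P => ?_⟩
  have h := hy P (PFunctor.M.corec y)
  rw [← PFunctor.M.dest_corec, PFunctor.M.mk_dest] at h
  exact h

lemma isTerm_of_reflTransGen {L L' : Tm} (h : Relation.ReflTransGen Tm.UnfRule L L') {n : ℕ}
    (hL : L.IsTerm n) : L'.IsTerm n := by
  induction h with
  | refl => exact hL
  | tail _ h ih => exact h.isTerm ih

lemma lt_of_freeIn_of_headStep {f : Productive → InfTm} (hf : ∀ P : Productive, HeadStep f P (f P))
    {i : ℕ} {N : InfTm} (h : N.FreeIn i) {P : Productive} (hP : f P = N) {n : ℕ}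
    (hn : P.1.IsTerm n) : i < n := by
  induction h generalizing P n with
  | var i =>
    have h := hf P
    generalize f P = N at h hP
    cases h with
    | var j h =>
      rw [← InfTm.var_injective hP]
      exact isTerm_of_reflTransGen h hn
    | lam Q h => simpa using congrArg InfTm.sym hP
    | app Q Q' h => simpa using congrArg InfTm.sym hP
  | lam _ ih =>
    have h := hf P
    generalize f P = N at h hP
    cases h with
    | var j h => simpa using congrArg InfTm.sym hP
    | lam Q h =>
      exact Nat.lt_of_succ_lt_succ (ih (InfTm.lam_injective hP) (isTerm_of_reflTransGen h hn))
    | app Q Q' h => simpa using congrArg InfTm.sym hP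
  | appLeft _ _ ih =>
    have h := hf P
    generalize f P = N at h hP
    cases h with
    | var j h => simpa using congrArg InfTm.sym hP
    | lam Q h => simpa using congrArg InfTm.sym hP
    | app Q Q' h => exact ih (InfTm.app_injective hP).1 (isTerm_of_reflTransGen h hn).1
  | appRight _ _ ih =>
    have h := hf P
    generalize f P = N at h hP
    cases h with
    | var j h => simpa using congrArg InfTm.sym hP
    | lam Q h => simpa using congrArg InfTm.sym hP
    | app Q Q' h => exact ih (InfTm.app_injective hP).2 (isTerm_of_reflTransGen h hn).2

/-! ### Strongly convergent unfolding sequences -/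

/-- `UnfoldedUpTo f d L N`: the symbols of `L` and `N` in depth less than `d` coincide, and in depth
`d` there are productive subterms of `L`, to which `f` assigns the corresponding subterms of `N`. -/
inductive UnfoldedUpTo (f : Productive → InfTm) : ℕ → Tm → InfTm → Prop
  | zero (P : Productive) : UnfoldedUpTo f 0 P (f P)
  | var (d i : ℕ) : UnfoldedUpTo f (d + 1) (.var i) (.var i)
  | lam {d : ℕ} {L : Tm} {M : InfTm} : UnfoldedUpTo f d L M →
      UnfoldedUpTo f (d + 1) (.lam L) (.lam M)
  | app {d : ℕ} {L₀ L₁ : Tm} {M₀ M₁ : InfTm} : UnfoldedUpTo f d L₀ M₀ → UnfoldedUpTo f d L₁ M₁ →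
      UnfoldedUpTo f (d + 1) (.app L₀ L₁) (.app M₀ M₁)

lemma UnfoldedUpTo.agreesUpTo {f : Productive → InfTm} {d : ℕ} {L : Tm} {N : InfTm}
    (h : UnfoldedUpTo f d L N) : AgreesUpTo d L N := by
  induction h with
  | zero P => exact .zero _ _
  | var d i => exact .var d i
  | lam _ ih => exact .lam ih
  | app _ _ ih₀ ih₁ => exact .app ih₀ ih₁

/-- One more level can be unfolded by steps in depth `d`. -/
lemma UnfoldedUpTo.exists_succ {f : Productive → InfTm}
    (hf : ∀ P : Productive, HeadStep f P (f P)) {d : ℕ} {L : Tm} {N : InfTm}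
    (h : UnfoldedUpTo f d L N) :
    ∃ L', Relation.ReflTransGen (Tm.UnfStep d) L L' ∧ UnfoldedUpTo f (d + 1) L' N := by
  induction h with
  | zero P =>
    have key {L : Tm} (h : Relation.ReflTransGen Tm.UnfRule P L) :
        Relation.ReflTransGen (Tm.UnfStep 0) P L := Relation.ReflTransGen.mono (fun _ _ => .root) _ _ h
    have h := hf P
    generalize f P = N at h
    cases h with
    | var i h => exact ⟨_, key h, .var 0 i⟩
    | lam Q h => exact ⟨_, key h, .lam (.zero Q)⟩
    | app Q Q' h => exact ⟨_, key h, .app (.zero Q) (.zero Q')⟩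
  | var d i => exact ⟨_, .refl, .var _ i⟩
  | lam _ ih =>
    obtain ⟨L', h₁, h₂⟩ := ih
    exact ⟨_, h₁.lift Tm.lam fun _ _ => .lam, .lam h₂⟩
  | @app d L₀ L₁ _ _ _ _ ih₀ ih₁ =>
    obtain ⟨L₀', h₁, h₂⟩ := ih₀
    obtain ⟨L₁', h₃, h₄⟩ := ih₁
    exact ⟨_, (h₁.lift (Tm.app · L₁) fun _ _ => .appLeft L₁).trans
      (h₃.lift (Tm.app L₀') fun _ _ => .appRight L₀'), .app h₂ h₄⟩

lemma AgreesUpTo.mono {d e : ℕ} {L : Tm} {N : InfTm} (h : AgreesUpTo e L N) (hde : d ≤ e) :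
    AgreesUpTo d L N := by
  induction h generalizing d with
  | zero => rw [Nat.le_zero.1 hde]; exact .zero _ _
  | var e i =>
    rcases d with _ | d
    · exact .zero _ _
    · exact .var d i
  | lam _ ih =>
    rcases d with _ | d
    · exact .zero _ _
    · exact .lam (ih (Nat.le_of_succ_le_succ hde))
  | app _ _ ih₀ ih₁ =>
    rcases d with _ | d
    · exact .zero _ _
    · exact .app (ih₀ (Nat.le_of_succ_le_succ hde)) (ih₁ (Nat.le_of_succ_le_succ hde))

/-- Steps in depth at least `d` do not change the symbols in smaller depth. -/
lemma AgreesUpTo.of_unfStep {d e : ℕ} {L L' : Tm} {N : InfTm} (h : AgreesUpTo d L N)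
    (hs : Tm.UnfStep e L L') (hde : d ≤ e) : AgreesUpTo d L' N := by
  induction h generalizing e L' with
  | zero => exact .zero _ _
  | var d i => cases hs with | root h => cases h
  | lam _ ih =>
    cases hs with
    | root h => cases h
    | lam hs => exact .lam (ih hs (Nat.le_of_succ_le_succ hde))
  | app h₀ h₁ ih₀ ih₁ =>
    cases hs with
    | root h => cases h
    | appLeft _ hs => exact .app (ih₀ hs (Nat.le_of_succ_le_succ hde)) h₁
    | appRight _ hs => exact .app h₀ (ih₁ hs (Nat.le_of_succ_le_succ hde))

/-- Finite reduction sequences with respect to relations `R 0, R 1, …` are joined to an infinite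
one, in which `δ n` is the index of the relation at time `n`. -/
lemma exists_concatenation {α : Type*} {R : ℕ → α → α → Prop} {T : ℕ → α}
    (h : ∀ d, Relation.ReflTransGen (R d) (T d) (T (d + 1))) :
    ∃ (s : ℕ → α) (δ : ℕ → ℕ), s 0 = T 0 ∧
      (∀ n, s (n + 1) = s n ∨ R (δ n) (s n) (s (n + 1))) ∧
      Filter.Tendsto δ Filter.atTop Filter.atTop ∧
      ∀ n, Relation.ReflTransGen (R (δ n)) (T (δ n)) (s n) := by
  -- `Path l d t`: from `t`, the end of the segment with number `d` is reached in `l` steps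
  let Path : ℕ → ℕ → α → Prop := fun l d => l.rec (fun t => t = T (d + 1))
    fun _ ih t => ∃ t', R d t t' ∧ ih t'
  have hPath (d) : ∃ l, Path l d (T d) := by
    have h' : ∀ {t}, Relation.ReflTransGen (R d) t (T (d + 1)) → ∃ l, Path l d t := by
      intro t ht
      induction ht using Relation.ReflTransGen.head_induction_on with
      | refl => exact ⟨0, rfl⟩
      | head hs _ ih =>
        obtain ⟨l, hl⟩ := ih
        exact ⟨l + 1, _, hs, hl⟩
    exact h' (h d)
  -- the configurations: the number of a segment, the remaining number of steps, the current object
  let C := {x : ℕ × ℕ × α // Path x.2.1 x.1 x.2.2 ∧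
    Relation.ReflTransGen (R x.1) (T x.1) x.2.2}
  have hnext (x : C) : ∃ y : C,
      (x.1.2.1 = 0 ∧ y.1.1 = x.1.1 + 1 ∧ y.1.2.2 = x.1.2.2) ∨
      (x.1.2.1 = y.1.2.1 + 1 ∧ y.1.1 = x.1.1 ∧ R x.1.1 x.1.2.2 y.1.2.2) := by
    obtain ⟨⟨d, l, t⟩, hl, ht⟩ := x
    rcases l with _ | l
    · obtain rfl : t = T (d + 1) := hl
      obtain ⟨l, hl⟩ := hPath (d + 1)
      exact ⟨⟨⟨d + 1, l, T (d + 1)⟩, hl, .refl⟩, .inl ⟨rfl, rfl, rfl⟩⟩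
    · obtain ⟨t', hs, hl⟩ := hl
      exact ⟨⟨⟨d, l, t'⟩, hl, ht.tail hs⟩, .inr ⟨rfl, rfl, hs⟩⟩
  choose next hnext using hnext
  obtain ⟨l₀, hl₀⟩ := hPath 0
  let c : ℕ → C := fun n => next^[n] ⟨⟨0, l₀, T 0⟩, hl₀, .refl⟩
  have hc (n) : c (n + 1) = next (c n) := Function.iterate_succ_apply' _ _ _
  refine ⟨fun n => (c n).1.2.2, fun n => (c n).1.1, rfl, fun n => ?_, ?_, fun n => (c n).2.2⟩
  · rcases hnext (c n) with ⟨-, -, h⟩ | ⟨-, -, h⟩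
    · exact .inl (by simp only [hc, h])
    · exact .inr (by simp only [hc]; exact h)
  · have hreach (l) : ∀ n, (c n).1.2.1 = l → ∃ n', (c n').1.1 = (c n).1.1 + 1 := by
      induction l with
      | zero =>
        intro n hn
        rcases hnext (c n) with ⟨-, h, -⟩ | ⟨h, -⟩
        · exact ⟨n + 1, by rw [hc, h]⟩
        · omega
      | succ l ih =>
        intro n hn
        rcases hnext (c n) with ⟨h, -⟩ | ⟨h, h', -⟩
        · omega
        · obtain ⟨n', hn'⟩ := ih (n + 1) (by rw [hc]; omega)
          exact ⟨n', by rw [hn', hc, h']⟩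
    refine Filter.tendsto_atTop_atTop_of_monotone (monotone_nat_of_le_succ fun n => ?_) fun b => ?_
    · rw [hc]
      rcases hnext (c n) with ⟨-, h, -⟩ | ⟨-, h, -⟩ <;> omega
    · induction b with
      | zero => exact ⟨0, Nat.zero_le _⟩
      | succ b ih =>
        obtain ⟨n, hn⟩ := ih
        obtain ⟨n', hn'⟩ := hreach _ n rfl
        exact ⟨n', by omega⟩

/-- A productive term is unfolded level by level. -/
lemma expresses_of_headStep {f : Productive → InfTm} (hf : ∀ P : Productive, HeadStep f P (f P))
    (P : Productive) : Expresses P (f P) := by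
  have hstep (d : ℕ) (L : Tm) : ∃ L', UnfoldedUpTo f d L (f P) →
      Relation.ReflTransGen (Tm.UnfStep d) L L' ∧ UnfoldedUpTo f (d + 1) L' (f P) := by
    by_cases h : UnfoldedUpTo f d L (f P)
    · obtain ⟨L', h'⟩ := h.exists_succ hf
      exact ⟨L', fun _ => h'⟩
    · exact ⟨L, fun h' => absurd h' h⟩
  choose g hg using hstep
  let T : ℕ → Tm := fun d => d.rec P.1 fun d L => g d L
  have hT (d : ℕ) : UnfoldedUpTo f d (T d) (f P) := by
    induction d with
    | zero => exact .zero P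
    | succ d ih => exact (hg d _ ih).2
  obtain ⟨s, δ, h₁, h₂, h₃, h₄⟩ :=
    exists_concatenation (R := Tm.UnfStep) (T := T) fun d => (hg d _ (hT d)).1
  refine ⟨s, δ, h₁, h₂, h₃, fun d => ?_⟩
  filter_upwards [h₃.eventually_ge_atTop d] with n hn
  refine AgreesUpTo.mono ?_ hn
  have hn := h₄ n
  generalize s n = t at hn
  induction hn with
  | refl => exact (hT _).agreesUpTo
  | tail _ hs ih => exact ih.of_unfStep hs le_rfl

theorem exists_expresses_iff {L : Tm} (hL : L.IsTerm 0) :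
    (∃ M : InfTm, M.Closed ∧ Expresses L M) ↔ L.depth ⊤ ⊤ = ⊤ := by
  refine ⟨fun ⟨M, _, h⟩ => h.depth_eq_top, fun h => ?_⟩
  have h0 : L.depth 0 ⊤ = ⊤ := by
    rw [Tm.depth_congr_const (κ' := ⊤) fun c hc => absurd hc hL.not_hasConst, h]
  obtain ⟨f, hf⟩ := exists_headStep
  exact ⟨f ⟨L, h0⟩, fun i hi => absurd (lt_of_freeIn_of_headStep hf hi rfl hL) (Nat.not_lt_zero i),
    expresses_of_headStep hf ⟨L, h0⟩⟩

end LetrecUnf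

theorem mainTheorem3 (L : LetrecUnf.Tm) (hL : L.IsTerm 0) :
    (∃ M : LetrecUnf.InfTm, M.Closed ∧ LetrecUnf.Expresses L M) ↔
      LetrecUnf.Derivable ⟨0, L⟩ :=
  (LetrecUnf.exists_expresses_iff hL).trans (LetrecUnf.derivable_iff hL).symm
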